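/- Let $k\ge 1$, let $\mathcal P$ be a set of $k+1$ pages, and let $G=\langle v_1,\dots,v_m\rangle$ be a finite simple path whose vertices are labeled with pages by a surjective map $\ell:\{v_1,\dots,v_m\}\to\mathcal P$ (a page may label several vertices). A request sequence of $G$ is $\sigma=(\ell(u_1),\dots,\ell(u_n))$, where $u_{t+1}=u_t$ or $u_tu_{t+1}$ is an edge of $G$ for every $t$. A paging algorithm has a memory of $k$ page slots, initially empty; a page enters the memory only when it is requested, and must be in memory right after its request; a request for a page that is not in memory is a fault. $\mathrm{OPT}(k,\sigma)$ is the least number of faults with which $\sigma$ can be served offline. Deterministic online algorithms know $G$, $k$ and the vertices $u_1,\dots,u_t$ requested so far; a randomized online algorithm is a probability distribution on deterministic ones. The strict competitive ratio $r_A(G,k)$ is the infimum of all $r$ with $E[A(k,\sigma)]\le r\,\mathrm{OPT}(k,\sigma)$ for all request sequences $\sigma$ of $G$, where $A(k,\sigma)$ is the number of faults of $A$; the asymptotic ratio $r_A^\infty(G,k)$ is the infimum of all $r$ for which there is $C\ge 0$ with $E[A(k,\sigma)]\le r\,\mathrm{OPT}(k,\sigma)+C$ for all $\sigma$; and $r^\infty_{\mathsf{obl}}(G,k)=\inf_A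 r_A^\infty(G,k)$ over the randomized online algorithms $A$. The requests are divided into phases: the first phase begins with the first request, and a new phase begins with each request for what would be the $(k+1)$-st distinct page of the current phase. A page is marked if it has been requested in the current phase (the current request included). For a vertex $v_i$ write $p\prec_i q$ if every path from $v_i$ to a vertex labeled $q$ includes a vertex labeled $p$; this is a partial order on $\mathcal P$, and $M_i$ denotes its set of maximal elements. MAXFAR is the following deterministic online algorithm. It evicts nothing at a hit or while a slot is free. At a fault with full memory in a phase that began at $v_i$, let $N$ be the set of unmarked pages of $M_i$ and $N'$ the set of those pages of $N$ that appear on both sides of $v_i$ in $G$. If $N'\neq\emptyset$, it evicts a middle element of $N'$ in the order in which these pages are first met going left from $v_i$ (a page with at most $|N'|/2$ elements of $N'$ before it and at most $|N'|/2$ after it); if $N'=\emptyset$, it evicts some page of $N$. Ties are broken arbitrarily. Then there is an absolute constant $c$ such that for all $k$, $\mathcal P$, $G$ and $\ell$ as above the following hold. 1. MAXFAR is well defined (a page to evict as prescribed exists in memory whenever one is needed), and, however ties are broken, $r_{\mathrm{MAXFAR}}(G,k)\le c\, r^\infty_{\mathsf{obl}}(G,k)$. The same holds if $r^\infty_{\mathsf{obl}}(G,k)$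 is taken only over the randomized online algorithms that see the names of the requested pages but not the vertices. 2. $\max_i\log|M_i|\le c\, r^\infty_{\mathsf{obl}}(G,k)$. 3. MAXFAR faults at most $c\,(1+\max_i\log|M_i|)$ times in every phase other than the first. -/

import Mathlib

open scoped ENNReal NNReal

noncomputable section

/-! ### Serving a sequence of page requests with `k` slots -/

/-- `C i` is the set of pages in memory after the first `i` requests of `ρ`. The memory has `k`
slots and is empty at the start; a page enters the memory only at a request for it, the requested
page is in memory after its request, and other pages may be evicted. -/
structure IsService {P : Type*} [DecidableEq P] (k : ℕ) (ρ : List P) (C : ℕ → Finset P) :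
    Prop where
  start : C 0 = ∅
  serves : ∀ i : Fin ρ.length, ρ.get i ∈ C (i + 1)
  demand : ∀ i : Fin ρ.length, C (i + 1) ⊆ insert (ρ.get i) (C i)
  slots : ∀ i : Fin ρ.length, (C (i + 1)).card ≤ k

/-- The number of page faults: requests for a page that is not in memory. -/
def faultCount {P : Type*} [DecidableEq P] (ρ : List P) (C : ℕ → Finset P) : ℕ :=
  (Finset.univ.filter fun i : Fin ρ.length => ρ.get i ∉ C i).card

/-- The optimal offline cost of a sequence of page requests (used with `k ≥ 1` only). -/
def optCost {P : Type*} [DecidableEq P] (k : ℕ) (ρ : List P) : ℕ :=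
  sInf {n | ∃ C : ℕ → Finset P, IsService k ρ C ∧ faultCount ρ C = n}

/-! ### Extended access graphs and online algorithms -/

/-- An undirected graph whose vertices are labeled with pages. -/
structure ExtendedAccessGraph (V P : Type*) where
  graph : SimpleGraph V
  label : V → P

namespace ExtendedAccessGraph

/-- The finite vertex sequences that generate the request sequences of `G`: consecutive vertices
are equal or adjacent. -/
def IsWalk {V P : Type*} (G : ExtendedAccessGraph V P) (σ : List V) : Prop :=
  σ.IsChain fun u v => u = v ∨ G.graph.Adj u v

end ExtendedAccessGraph

/-- A deterministic online paging algorithm for `G` with `k` slots: `serve σ` is the set of pages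
in memory after the requests `σ`, chosen with knowledge of `G`, `k` and the requests so far. The
algorithm is shown the requested vertices, not only their labels. -/
structure OnlineAlg {V P : Type*} [DecidableEq P] (G : ExtendedAccessGraph V P) (k : ℕ) where
  serve : List V → Finset P
  valid : ∀ σ : List V, IsService k (σ.map G.label) (fun i => serve (σ.take i))

namespace OnlineAlg

variable {V P : Type*} [DecidableEq P] {G : ExtendedAccessGraph V P} {k : ℕ}

/-- The number of faults of `A` on the requests generated by `σ`. -/
def faults (A : OnlineAlg G k) (σ : List V) : ℕ :=
  faultCount (σ.map G.label) (fun i => A.serve (σ.take i))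

/-- The decisions of the algorithm depend only on the names of the requested pages. -/
def PagesOnly (A : OnlineAlg G k) : Prop :=
  ∀ σ τ : List V, σ.map G.label = τ.map G.label → A.serve σ = A.serve τ

/-- The strict competitive ratio of a deterministic algorithm. -/
def strictRatio (A : OnlineAlg G k) : ℝ≥0∞ :=
  sInf {r : ℝ≥0∞ | ∀ σ : List V, G.IsWalk σ →
    (A.faults σ : ℝ≥0∞) ≤ r * (optCost k (σ.map G.label) : ℝ≥0∞)}

/-- The σ-algebra generated by all the decisions `A ↦ A.serve σ`. -/
instance : MeasurableSpace (OnlineAlg G k) :=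
  ⨆ σ : List V, MeasurableSpace.comap (fun A : OnlineAlg G k => A.serve σ) ⊤

end OnlineAlg

/-- A randomized online algorithm is a probability distribution on deterministic ones; against an
oblivious adversary its cost on `σ` is the expected number of faults. -/
def expectedFaults {V P : Type*} [DecidableEq P] {G : ExtendedAccessGraph V P} {k : ℕ}
    (μ : MeasureTheory.ProbabilityMeasure (OnlineAlg G k)) (σ : List V) : ℝ≥0∞ :=
  ∫⁻ A, (A.faults σ : ℝ≥0∞) ∂(μ : MeasureTheory.Measure (OnlineAlg G k))

/-- The asymptotic competitive ratio of a randomized algorithm. -/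
def asymptoticRatio {V P : Type*} [DecidableEq P] {G : ExtendedAccessGraph V P} {k : ℕ}
    (μ : MeasureTheory.ProbabilityMeasure (OnlineAlg G k)) : ℝ≥0∞ :=
  sInf {r : ℝ≥0∞ | ∃ C : ℝ≥0, ∀ σ : List V, G.IsWalk σ →
    expectedFaults μ σ ≤ r * (optCost k (σ.map G.label) : ℝ≥0∞) + (C : ℝ≥0∞)}

namespace ExtendedAccessGraph

variable {V P : Type*} [DecidableEq P]

/-- The randomized asymptotic competitive ratio of the paging problem `(G, k)`, over the
algorithms that are shown the requested vertices. -/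
def rOblAsymp (G : ExtendedAccessGraph V P) (k : ℕ) : ℝ≥0∞ :=
  ⨅ μ : MeasureTheory.ProbabilityMeasure (OnlineAlg G k), asymptoticRatio μ

/-- The same ratio over the algorithms that are shown only the names of the requested pages. -/
def rOblAsympPages (G : ExtendedAccessGraph V P) (k : ℕ) : ℝ≥0∞ :=
  ⨅ μ : {μ : MeasureTheory.ProbabilityMeasure (OnlineAlg G k) //
    ∀ᵐ A ∂(μ : MeasureTheory.Measure (OnlineAlg G k)), A.PagesOnly}, asymptoticRatio μ.1

/-- The current phase after the requests `σ`: a request that would be for the `(k+1)`-st distinct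
page of the phase begins a new phase. -/
def currentPhase (G : ExtendedAccessGraph V P) (k : ℕ) (σ : List V) : List V :=
  σ.foldl (fun ph v =>
    if ((ph ++ [v]).map G.label).toFinset.card ≤ k then ph ++ [v] else [v]) []

/-- The pages requested in the current phase. -/
def marked (G : ExtendedAccessGraph V P) (k : ℕ) (σ : List V) : Finset P :=
  ((G.currentPhase k σ).map G.label).toFinset

/-- `p ≺_v q`: every path from `v` to a vertex labeled `q` includes a vertex labeled `p`. -/
def Precedes (G : ExtendedAccessGraph V P) (v : V) (p q : P) : Prop :=
  ∀ (u : V) (w : G.graph.Walk v u), G.label u = q → ∃ x ∈ w.support, G.label x = p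

open scoped Classical in
/-- The set of `≺_v`-maximal pages. -/
def maximalPages [Fintype P] (G : ExtendedAccessGraph V P) (v : V) : Finset P :=
  Finset.univ.filter fun p => ∀ q, G.Precedes v p q → q = p

end ExtendedAccessGraph

/-! ### Simple paths and the algorithm MAXFAR -/

/-- The path `0, 1, …, m - 1` (from left to right) labeled by `ℓ`. -/
def pathEAG {m : ℕ} {P : Type*} (ℓ : Fin m → P) : ExtendedAccessGraph (Fin m) P where
  graph := SimpleGraph.pathGraph m
  label := ℓ

/-- The page `p` appears on both sides of the vertex `i`. -/
def OnBothSides {m : ℕ} {P : Type*} (ℓ : Fin m → P) (i : Fin m) (p : P) : Prop :=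
  (∃ a, a < i ∧ ℓ a = p) ∧ (∃ b, i < b ∧ ℓ b = p)

/-- Going left from `i`, a vertex labeled `p` is reached before any vertex labeled `q`. -/
def LeftBefore {m : ℕ} {P : Type*} (ℓ : Fin m → P) (i : Fin m) (p q : P) : Prop :=
  ∃ a, a < i ∧ ℓ a = p ∧ ∀ b, a ≤ b → b < i → ℓ b ≠ q

open scoped Classical in
/-- `q` is a middle element of the set `N` in the order of first appearance to the left of `i`. -/
def IsMiddle {m : ℕ} {P : Type*} (ℓ : Fin m → P) (i : Fin m) (N : Finset P) (q : P) : Prop :=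
  q ∈ N ∧ 2 * (N.filter fun p => LeftBefore ℓ i p q).card ≤ N.card ∧
    2 * (N.filter fun p => LeftBefore ℓ i q p).card ≤ N.card

section

variable {m : ℕ} {P : Type*} [Fintype P] [DecidableEq P]

/-- The set of unmarked `≺_i`-maximal pages after the requests `σ`. -/
def unmarkedMaximal (ℓ : Fin m → P) (k : ℕ) (σ : List (Fin m)) (i : Fin m) : Finset P :=
  (pathEAG ℓ).maximalPages i \ (pathEAG ℓ).marked k σ

open scoped Classical in
/-- MAXFAR may evict `q` at a fault on the last request of `σ`: with `i` the vertex at which the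
current phase began, `q` is a middle element among those unmarked `≺_i`-maximal pages that appear
on both sides of `i`, or any unmarked `≺_i`-maximal page if none of them appears on both sides. -/
def MaxfarVictim (ℓ : Fin m → P) (k : ℕ) (σ : List (Fin m)) (q : P) : Prop :=
  ∃ i, ((pathEAG ℓ).currentPhase k σ).head? = some i ∧
    if ((unmarkedMaximal ℓ k σ i).filter fun p => OnBothSides ℓ i p).Nonempty then
      IsMiddle ℓ i ((unmarkedMaximal ℓ k σ i).filter fun p => OnBothSides ℓ i p) q
    else q ∈ unmarkedMaximal ℓ k σ i

/-- `A` is the algorithm MAXFAR, with some way to break ties: nothing is evicted at a hit or while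
a slot is free, and at a fault with full memory one page is evicted, by the rule of MAXFAR. -/
def IsMaxfar (ℓ : Fin m → P) (k : ℕ) (A : OnlineAlg (pathEAG ℓ) k) : Prop :=
  ∀ (σ : List (Fin m)) (v : Fin m), (pathEAG ℓ).IsWalk (σ ++ [v]) →
    (ℓ v ∈ A.serve σ → A.serve (σ ++ [v]) = A.serve σ) ∧
    (ℓ v ∉ A.serve σ → (A.serve σ).card < k →
      A.serve (σ ++ [v]) = insert (ℓ v) (A.serve σ)) ∧
    (ℓ v ∉ A.serve σ → (A.serve σ).card = k →
      ∃ q ∈ A.serve σ, MaxfarVictim ℓ k (σ ++ [v]) q ∧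
        A.serve (σ ++ [v]) = insert (ℓ v) ((A.serve σ).erase q))

/-- `max_i log |M_i|`, with `M_i` the set of `≺_i`-maximal pages. -/
def maxLogMaximal (ℓ : Fin m → P) : ℝ :=
  ⨆ i : Fin m, Real.log ((pathEAG ℓ).maximalPages i).card

end

end

/-!
The number of phase changes is a lower bound for `OPT`, because a phase together with the first
request of the next one comprises `k + 1` distinct pages.

*Lower bound.* The adversary halves a set of `≺_i`-maximal pages, in the order of first appearance
to the left of `i`, by a fair coin, and then tours from `i` all the pages that can be reached
without touching the surviving half. By maximality every page is on one of the two possible tours,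
so a deterministic algorithm, whose memory misses some page, faults with probability at least
`1 / 2`. A round of about `log₂ |M_i|` halvings ends with a single page that was never requested in
the round. Keeping this page out of its memory, the offline algorithm faults about once per round.

*Upper bound.* The requests of a phase form an interval around its starting vertex `i`. When the
page that MAXFAR evicted, a middle element of `N'`, is requested again, this interval has grown to
the left or to the right up to the page, and thereby half of `N'` is marked. At most two maximal
pages appear on one side of `i` only, so there are at most `log₂ |M_i| + O(1)` faults in a phase.
-/

open scoped Finset

/-! ### Services -/

section Services

variable {P : Type*} [DecidableEq P] {k n : ℕ} {ρ τ : List P} {p q : P} {C D : ℕ → Finset P}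
  {S S' : Finset P}

@[simp] theorem faultCount_nil (C : ℕ → Finset P) : faultCount ([] : List P) C = 0 :=
  rfl

theorem faultCount_append_singleton (ρ : List P) (p : P) (C : ℕ → Finset P) :
    faultCount (ρ ++ [p]) C = faultCount ρ C + if p ∈ C ρ.length then 0 else 1 := by
  have hlength : ρ.length + 1 = (ρ ++ [p]).length := by simp
  simp only [faultCount, Finset.card_filter, ← (finCongr hlength).sum_comp,
    Fin.sum_univ_castSucc]
  simp

theorem faultCount_congr (h : ∀ i < ρ.length, C i = D i) : faultCount ρ C = faultCount ρ D := by
  unfold faultCount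
  congr 1
  ext i
  simp [h i i.2]

namespace IsService

theorem nil_iff : IsService k ([] : List P) C ↔ C 0 = ∅ :=
  ⟨start, fun h => ⟨h, fun i => i.elim0, fun i => i.elim0, fun i => i.elim0⟩⟩

theorem append_singleton_iff :
    IsService k (ρ ++ [p]) C ↔ IsService k ρ C ∧ p ∈ C (ρ.length + 1) ∧
      C (ρ.length + 1) ⊆ insert p (C ρ.length) ∧ #(C (ρ.length + 1)) ≤ k := by
  have hlength : ρ.length + 1 = (ρ ++ [p]).length := by simp
  have hforall {motive : Fin (ρ ++ [p]).length → Prop} :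
      (∀ i, motive i) ↔ (∀ i : Fin ρ.length, motive (finCongr hlength i.castSucc)) ∧
        motive (finCongr hlength (Fin.last _)) := by
    rw [← (finCongr hlength).forall_congr_right, Fin.forall_fin_succ']
  constructor
  · rintro ⟨hstart, hserves, hdemand, hslots⟩
    obtain ⟨hserves, hp⟩ := hforall.1 hserves
    obtain ⟨hdemand, hsub⟩ := hforall.1 hdemand
    obtain ⟨hslots, hcard⟩ := hforall.1 hslots
    exact ⟨⟨hstart, by simpa using hserves, by simpa using hdemand, by simpa using hslots⟩,
      by simpa using hp, by simpa using hsub, by simpa using hcard⟩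
  · rintro ⟨⟨hstart, hserves, hdemand, hslots⟩, hp, hsub, hcard⟩
    refine ⟨hstart, hforall.2 ⟨?_, ?_⟩, hforall.2 ⟨?_, ?_⟩, hforall.2 ⟨?_, ?_⟩⟩ <;> simpa

theorem congr (hC : IsService k ρ C) (h : ∀ i ≤ ρ.length, C i = D i) : IsService k ρ D where
  start := h 0 (Nat.zero_le _) ▸ hC.start
  serves i := h _ i.2 ▸ hC.serves i
  demand i := h _ i.2 ▸ h _ i.2.le ▸ hC.demand i
  slots i := h _ i.2 ▸ hC.slots i

theorem of_append (h : IsService k (ρ ++ τ) C) : IsService k ρ C := by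
  induction τ using List.reverseRecOn with
  | nil => simpa using h
  | append_singleton τ p ih =>
    rw [← List.append_assoc] at h
    exact ih (append_singleton_iff.1 h).1

theorem card_le (h : IsService k ρ C) : #(C ρ.length) ≤ k := by
  cases ρ using List.reverseRecOn with
  | nil => simp [h.start]
  | append_singleton ρ p => simpa using (append_singleton_iff.1 h).2.2.2

theorem subset_union (h : IsService k (ρ ++ τ) C) :
    C (ρ ++ τ).length ⊆ C ρ.length ∪ τ.toFinset := by
  induction τ using List.reverseRecOn with
  | nil => simp
  | append_singleton τ p ih =>
    rw [← List.append_assoc] at h ⊢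
    obtain ⟨hinit, -, hdemand, -⟩ := append_singleton_iff.1 h
    have := hdemand.trans (Finset.insert_subset_insert p (ih hinit))
    simpa [← Finset.union_insert, add_assoc] using this

theorem faultCount_add_card_sdiff_le (h : IsService k (ρ ++ τ) C) :
    faultCount ρ C + #(τ.toFinset \ C ρ.length) ≤ faultCount (ρ ++ τ) C := by
  induction τ using List.reverseRecOn with
  | nil => simp
  | append_singleton τ p ih =>
    rw [← List.append_assoc] at h ⊢
    obtain ⟨hinit, -⟩ := append_singleton_iff.1 h
    have htoFinset : (τ ++ [p]).toFinset = insert p τ.toFinset := by simp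
    rw [faultCount_append_singleton, htoFinset]
    refine le_trans ?_ (Nat.add_le_add_right (ih hinit) _)
    rw [add_assoc]
    gcongr
    split_ifs with hp
    · refine Finset.card_le_card fun x => ?_
      have := hinit.subset_union hp
      grind
    · have : insert p τ.toFinset \ C ρ.length ⊆ insert p (τ.toFinset \ C ρ.length) := by grind
      exact (Finset.card_le_card this).trans (Finset.card_insert_le _ _)

theorem faultCount_le_append (h : IsService k (ρ ++ τ) C) :
    faultCount ρ C ≤ faultCount (ρ ++ τ) C :=
  le_of_add_le_left h.faultCount_add_card_sdiff_le

theorem faultCount_lt_append (h : IsService k (ρ ++ τ) C) (hp : p ∉ C ρ.length) (hτ : p ∈ τ) :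
    faultCount ρ C < faultCount (ρ ++ τ) C := by
  have : 0 < #(τ.toFinset \ C ρ.length) := Finset.card_pos.2 ⟨p, by simp [hp, hτ]⟩
  have := h.faultCount_add_card_sdiff_le
  omega

theorem card_toFinset_le (h : IsService k ρ C) : #ρ.toFinset ≤ faultCount ρ C := by
  simpa [h.start] using faultCount_add_card_sdiff_le (ρ := []) h

theorem optCost_le (h : IsService k ρ C) : optCost k ρ ≤ faultCount ρ C :=
  Nat.sInf_le ⟨C, h, rfl⟩

end IsService

/-- The requests `ρ` can be served with at most `n` faults so that the memory is `S` at the end. -/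
def CanServe (k : ℕ) (ρ : List P) (n : ℕ) (S : Finset P) : Prop :=
  ∃ C : ℕ → Finset P, IsService k ρ C ∧ faultCount ρ C ≤ n ∧ C ρ.length = S

namespace CanServe

theorem nil : CanServe k ([] : List P) 0 ∅ :=
  ⟨fun _ => ∅, IsService.nil_iff.2 rfl, le_rfl, rfl⟩

theorem append_singleton (h : CanServe k ρ n S) (hp : p ∈ S') (hsub : S' ⊆ insert p S)
    (hcard : #S' ≤ k) : CanServe k (ρ ++ [p]) (n + if p ∈ S then 0 else 1) S' := by
  obtain ⟨C, hC, hn, rfl⟩ := h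
  have hcongr : ∀ i ≤ ρ.length, C i = if i ≤ ρ.length then C i else S' :=
    fun i hi => (if_pos hi).symm
  refine ⟨fun i => if i ≤ ρ.length then C i else S',
    IsService.append_singleton_iff.2 ⟨hC.congr hcongr, ?_⟩, ?_, by simp⟩
  · simpa using ⟨hp, hsub, hcard⟩
  · rw [faultCount_append_singleton, ← faultCount_congr fun i hi => hcongr i hi.le]
    simpa using hn

theorem optCost_le (h : CanServe k ρ n S) : optCost k ρ ≤ n := by
  obtain ⟨C, hC, hn, -⟩ := h
  exact hC.optCost_le.trans hn

theorem card_le (h : CanServe k ρ n S) : #S ≤ k := by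
  obtain ⟨C, hC, -, rfl⟩ := h
  exact hC.card_le

-- Evicting `q` and nothing else loses at most one page, and from then on every fault fills a slot.
theorem append_of_notMem [Fintype P] (hP : Fintype.card P ≤ k + 1) (h : CanServe k ρ (n + #S) S)
    (hq : q ∉ τ) : ∃ S', CanServe k (ρ ++ τ) (n + 1 + #S') S' := by
  suffices hsuff : ∃ n' S', CanServe k (ρ ++ τ) n' S' ∧ n' ≤ n + 1 + #(S'.erase q) by
    obtain ⟨n', S', ⟨C, hC, hfaults, hS'⟩, hn'⟩ := hsuff
    exact ⟨S', C, hC, by have := S'.card_erase_le (a := q); omega, hS'⟩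
  induction τ using List.reverseRecOn with
  | nil =>
    have := Finset.pred_card_le_card_erase (s := S) (a := q)
    exact ⟨_, S, by simpa using h, by omega⟩
  | append_singleton τ p ih =>
    simp only [List.mem_append, List.mem_singleton, not_or] at hq
    obtain ⟨n', S', hserve, hn'⟩ := ih hq.1
    have hcard : #(insert p (S'.erase q)) ≤ k := by
      have : insert p (S'.erase q) ⊆ Finset.univ.erase q := by grind
      have := Finset.card_le_card this
      rw [Finset.card_erase_of_mem (Finset.mem_univ q), Finset.card_univ] at this
      omega
    rw [← List.append_assoc]
    refine ⟨_, _, hserve.append_singleton (Finset.mem_insert_self _ _)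
      (Finset.insert_subset_insert p (S'.erase_subset q)) hcard, ?_⟩
    rw [Finset.erase_insert_of_ne (Ne.symm hq.2), Finset.erase_idem]
    by_cases hp : p ∈ S'
    · rw [if_pos hp, Finset.insert_eq_self.2 (Finset.mem_erase.2 ⟨Ne.symm hq.2, hp⟩)]
      exact hn'
    · rw [if_neg hp, Finset.card_insert_of_notMem fun h => hp (Finset.mem_of_mem_erase h)]
      omega

end CanServe

theorem exists_isService (hk : 1 ≤ k) (ρ : List P) : ∃ C : ℕ → Finset P, IsService k ρ C := by
  suffices hsuff : ∃ n S, CanServe k ρ n S by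
    obtain ⟨n, S, C, hC, -⟩ := hsuff
    exact ⟨C, hC⟩
  induction ρ using List.reverseRecOn with
  | nil => exact ⟨0, ∅, .nil⟩
  | append_singleton ρ p ih =>
    obtain ⟨n, S, h⟩ := ih
    exact ⟨_, {p}, h.append_singleton (Finset.mem_singleton_self p) (by simp) (by simpa)⟩

theorem exists_isService_faultCount_eq_optCost (hk : 1 ≤ k) (ρ : List P) :
    ∃ C : ℕ → Finset P, IsService k ρ C ∧ faultCount ρ C = optCost k ρ := by
  obtain ⟨C, hC⟩ := exists_isService hk ρ
  exact Nat.sInf_mem (s := {n | ∃ C : ℕ → Finset P, IsService k ρ C ∧ faultCount ρ C = n})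
    ⟨_, C, hC, rfl⟩

theorem le_optCost (hk : 1 ≤ k) (h : ∀ C, IsService k ρ C → n ≤ faultCount ρ C) :
    n ≤ optCost k ρ := by
  obtain ⟨C, hC, hopt⟩ := exists_isService_faultCount_eq_optCost hk ρ
  exact hopt ▸ h C hC

theorem optCost_flatten_le [Fintype P] (hP : Fintype.card P ≤ k + 1) (L : List (List P))
    (hL : ∀ τ ∈ L, ∃ q, q ∉ τ) : optCost k L.flatten ≤ L.length + k := by
  suffices hsuff : ∃ S, CanServe k L.flatten (L.length + #S) S by
    obtain ⟨S, hS⟩ := hsuff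
    exact hS.optCost_le.trans (Nat.add_le_add_left hS.card_le _)
  induction L using List.reverseRecOn with
  | nil => exact ⟨∅, by simpa using CanServe.nil⟩
  | append_singleton L τ ih =>
    obtain ⟨S, hS⟩ := ih fun τ hτ => hL τ (List.mem_append_left _ hτ)
    obtain ⟨q, hq⟩ := hL τ (by simp)
    simpa using hS.append_of_notMem hP hq

end Services

/-! ### Online algorithms and phases -/

section OnlineAlgorithms

variable {V P : Type*} [DecidableEq P] {G : ExtendedAccessGraph V P} {k : ℕ} {σ τ : List V}
  {v : V} {p : P}

namespace OnlineAlg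

theorem faultCount_serve_append (A : OnlineAlg G k) (σ τ : List V) :
    faultCount (σ.map G.label) (fun i => A.serve ((σ ++ τ).take i)) = A.faults σ :=
  faultCount_congr fun i hi => by
    rw [List.length_map] at hi
    rw [List.take_append_of_le_length hi.le]

@[simp] theorem faults_nil (A : OnlineAlg G k) : A.faults [] = 0 :=
  faultCount_nil _

theorem faults_append_singleton (A : OnlineAlg G k) (σ : List V) (v : V) :
    A.faults (σ ++ [v]) = A.faults σ + if G.label v ∈ A.serve σ then 0 else 1 := by
  rw [← A.faultCount_serve_append σ [v]]
  simp only [faults, List.map_append, List.map_singleton, faultCount_append_singleton,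
    List.length_map, List.take_left']

@[simp] theorem serve_nil (A : OnlineAlg G k) : A.serve [] = ∅ :=
  (A.valid []).start

theorem card_serve_le (A : OnlineAlg G k) (σ : List V) : #(A.serve σ) ≤ k := by
  simpa using (A.valid σ).card_le

theorem isService_append (A : OnlineAlg G k) (σ τ : List V) :
    IsService k (σ.map G.label ++ τ.map G.label) fun i => A.serve ((σ ++ τ).take i) :=
  List.map_append ▸ A.valid (σ ++ τ)

theorem faultCount_append (A : OnlineAlg G k) (σ τ : List V) :
    faultCount (σ.map G.label ++ τ.map G.label) (fun i => A.serve ((σ ++ τ).take i)) =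
      A.faults (σ ++ τ) := by
  rw [faults, List.map_append]

theorem faults_lt_append (A : OnlineAlg G k) (hp : p ∉ A.serve σ) (hτ : p ∈ τ.map G.label) :
    A.faults σ < A.faults (σ ++ τ) := by
  have := (A.isService_append σ τ).faultCount_lt_append (by simpa using hp) hτ
  rwa [faultCount_serve_append, faultCount_append] at this

theorem faults_le_append (A : OnlineAlg G k) (σ τ : List V) : A.faults σ ≤ A.faults (σ ++ τ) := by
  have := (A.isService_append σ τ).faultCount_le_append
  rwa [faultCount_serve_append, faultCount_append] at this

theorem optCost_le_faults (A : OnlineAlg G k) (σ : List V) :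
    optCost k (σ.map G.label) ≤ A.faults σ :=
  (A.valid σ).optCost_le

/-- The online algorithm that turns the memory `S` into `step σ S v` when the vertex `v` is
requested after the requests `σ`. -/
def ofStep (step : List V → Finset P → V → Finset P)
    (mem_step : ∀ σ S v, G.label v ∈ step σ S v)
    (step_subset : ∀ σ S v, step σ S v ⊆ insert (G.label v) S)
    (card_step_le : ∀ σ S v, #S ≤ k → #(step σ S v) ≤ k) : OnlineAlg G k where
  serve σ := σ.reverseRecOn ∅ fun σ v S => step σ S v
  valid σ := by
    induction σ using List.reverseRecOn with
    | nil => exact IsService.nil_iff.2 (List.reverseRecOn_nil _ _)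
    | append_singleton σ v ih =>
      rw [List.map_append, List.map_singleton, IsService.append_singleton_iff]
      refine ⟨ih.congr fun i hi => ?_, ?_⟩
      · rw [List.length_map] at hi
        rw [List.take_append_of_le_length hi]
      · have hcard := ih.card_le
        simp only [List.length_map, List.take_length] at hcard
        simpa [List.take_of_length_le, List.reverseRecOn_concat] using
          ⟨mem_step σ _ v, step_subset σ _ v, card_step_le σ _ v hcard⟩

theorem ofStep_serve_append_singleton (step : List V → Finset P → V → Finset P)
    (mem_step : ∀ σ S v, G.label v ∈ step σ S v)
    (step_subset : ∀ σ S v, step σ S v ⊆ insert (G.label v) S)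
    (card_step_le : ∀ σ S v, #S ≤ k → #(step σ S v) ≤ k) (σ : List V) (v : V) :
    (ofStep step mem_step step_subset card_step_le).serve (σ ++ [v]) =
      step σ ((ofStep step mem_step step_subset card_step_le).serve σ) v := by
  simp only [ofStep, List.reverseRecOn_concat]

end OnlineAlg

namespace ExtendedAccessGraph

theorem toFinset_map_append_singleton (σ : List V) (v : V) :
    ((σ ++ [v]).map G.label).toFinset = insert (G.label v) (σ.map G.label).toFinset := by
  ext; simp

/-- The request for `v` after the requests `σ` begins a new phase, and the current phase ends
before it. The very first request does not count. -/
def StartsPhase (G : ExtendedAccessGraph V P) (k : ℕ) (σ : List V) (v : V) : Prop :=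
  k < #(insert (G.label v) (G.marked k σ))

instance (G : ExtendedAccessGraph V P) (k : ℕ) (σ : List V) (v : V) :
    Decidable (G.StartsPhase k σ v) :=
  inferInstanceAs (Decidable (k < _))

@[simp] theorem marked_nil : G.marked k [] = ∅ :=
  rfl

theorem currentPhase_append_singleton (σ : List V) (v : V) :
    G.currentPhase k (σ ++ [v]) =
      if G.StartsPhase k σ v then [v] else G.currentPhase k σ ++ [v] := by
  simp only [StartsPhase, marked, ← toFinset_map_append_singleton, ← not_le, ite_not]
  simp [currentPhase]

theorem marked_append_singleton (σ : List V) (v : V) :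
    G.marked k (σ ++ [v]) =
      if G.StartsPhase k σ v then {G.label v} else insert (G.label v) (G.marked k σ) := by
  rw [marked, currentPhase_append_singleton]
  split_ifs
  · simp
  · rw [toFinset_map_append_singleton, marked]

theorem label_mem_marked_append_singleton (σ : List V) (v : V) :
    G.label v ∈ G.marked k (σ ++ [v]) := by
  rw [marked_append_singleton]
  split_ifs <;> simp

theorem marked_append_singleton_subset (σ : List V) (v : V) :
    G.marked k (σ ++ [v]) ⊆ insert (G.label v) (G.marked k σ) := by
  rw [marked_append_singleton]
  split_ifs <;> simp

theorem card_marked_le (hk : 1 ≤ k) (σ : List V) : #(G.marked k σ) ≤ k := by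
  cases σ using List.reverseRecOn with
  | nil => simp
  | append_singleton σ v =>
    rw [marked_append_singleton]
    split_ifs with h
    · simpa
    · exact not_lt.1 h

theorem exists_eq_append_currentPhase (σ : List V) : ∃ pre, σ = pre ++ G.currentPhase k σ := by
  induction σ using List.reverseRecOn with
  | nil => exact ⟨[], rfl⟩
  | append_singleton σ v ih =>
    rw [currentPhase_append_singleton]
    split_ifs
    · exact ⟨σ, rfl⟩
    · obtain ⟨pre, h⟩ := ih
      exact ⟨pre, by rw [← List.append_assoc, ← h]⟩

theorem currentPhase_ne_nil (hσ : σ ≠ []) : G.currentPhase k σ ≠ [] := by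
  cases σ using List.reverseRecOn with
  | nil => exact absurd rfl hσ
  | append_singleton σ v =>
    rw [currentPhase_append_singleton]
    split_ifs <;> simp

theorem IsWalk.currentPhase (hσ : G.IsWalk σ) : G.IsWalk (G.currentPhase k σ) := by
  obtain ⟨pre, h⟩ := exists_eq_append_currentPhase (G := G) (k := k) σ
  rw [IsWalk, h] at hσ
  exact hσ.right_of_append

theorem startsPhase_of_currentPhase_eq (hσ : σ ≠ []) (h : G.currentPhase k (σ ++ [v]) = [v]) :
    G.StartsPhase k σ v := by
  by_contra hstart
  rw [currentPhase_append_singleton, if_neg hstart] at h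
  exact currentPhase_ne_nil hσ (by simpa using h)

theorem currentPhase_eq_of_append_singleton {x : V}
    (h : G.currentPhase k (σ ++ v :: (τ ++ [x])) = v :: (τ ++ [x])) :
    G.currentPhase k (σ ++ v :: τ) = v :: τ ∧ ¬ G.StartsPhase k (σ ++ v :: τ) x := by
  rw [← List.cons_append, ← List.append_assoc, currentPhase_append_singleton] at h
  split_ifs at h with hstart
  · simp at h
  · exact ⟨List.append_cancel_right h, hstart⟩

/-- The number of phases begun by the requests `σ`, not counting the first one. -/
def phaseChanges (G : ExtendedAccessGraph V P) (k : ℕ) (σ : List V) : ℕ :=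
  σ.reverseRecOn 0 fun σ v n => n + if G.StartsPhase k σ v then 1 else 0

@[simp] theorem phaseChanges_nil : G.phaseChanges k [] = 0 := by
  simp only [phaseChanges, List.reverseRecOn_nil]

theorem phaseChanges_append_singleton (σ : List V) (v : V) :
    G.phaseChanges k (σ ++ [v]) =
      G.phaseChanges k σ + if G.StartsPhase k σ v then 1 else 0 := by
  simp only [phaseChanges, List.reverseRecOn_concat]

theorem phaseChanges_append (hσ : σ ≠ []) (h : G.currentPhase k (σ ++ τ) = τ) :
    G.phaseChanges k (σ ++ τ) = G.phaseChanges k σ + 1 := by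
  obtain ⟨v, τ, rfl⟩ := List.exists_cons_of_ne_nil
    (h ▸ currentPhase_ne_nil (by simp [hσ]) : τ ≠ [])
  induction τ using List.reverseRecOn with
  | nil => rw [phaseChanges_append_singleton, if_pos (startsPhase_of_currentPhase_eq hσ h)]
  | append_singleton τ x ih =>
    obtain ⟨hphase, hstart⟩ := currentPhase_eq_of_append_singleton h
    rw [← List.cons_append, ← List.append_assoc, phaseChanges_append_singleton, if_neg hstart,
      ih hphase, add_zero]

-- The first request `ρ.getLast` of the phase leaves its page in memory, and the memory together
-- with the later requests `τ` of the phase and the first request of the next one comprises `k + 1`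
-- pages, so one of these later requests is a fault.
theorem phaseChanges_le_faultCount {C : ℕ → Finset P} (hC : IsService k (σ.map G.label) C) :
    G.phaseChanges k σ ≤ faultCount (σ.map G.label) C := by
  suffices hsuff : ∃ ρ τ, σ.map G.label = ρ ++ τ ∧ G.phaseChanges k σ ≤ faultCount ρ C ∧
      G.marked k σ ⊆ C ρ.length ∪ τ.toFinset by
    obtain ⟨ρ, τ, hρτ, hle, -⟩ := hsuff
    rw [hρτ] at hC ⊢
    exact hle.trans hC.faultCount_le_append
  induction σ using List.reverseRecOn with
  | nil => exact ⟨[], [], rfl, by simp, by simp⟩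
  | append_singleton σ v ih =>
    rw [List.map_append, List.map_singleton] at hC ⊢
    obtain ⟨hinit, hserves, -⟩ := IsService.append_singleton_iff.1 hC
    obtain ⟨ρ, τ, hρτ, hle, hmarked⟩ := ih hinit
    rw [hρτ] at hC hserves hinit ⊢
    have hinsert : insert (G.label v) (G.marked k σ) ⊆
        C ρ.length ∪ (τ ++ [G.label v]).toFinset := by
      simpa [← Finset.union_insert] using Finset.insert_subset_insert _ hmarked
    rw [phaseChanges_append_singleton, marked_append_singleton]
    split_ifs with hstart
    · obtain ⟨p, hp, hpC⟩ := Finset.exists_mem_notMem_of_card_lt_card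
        (hinit.of_append.card_le.trans_lt hstart)
      refine ⟨ρ ++ τ ++ [G.label v], [], by simp, hle.trans_lt ?_,
        by simpa [add_assoc] using hserves⟩
      rw [List.append_assoc] at hC ⊢
      exact hC.faultCount_lt_append hpC
        (List.mem_toFinset.1 ((Finset.mem_union.1 (hinsert hp)).resolve_left hpC))
    · exact ⟨ρ, τ ++ [G.label v], by simp, hle, hinsert⟩

theorem phaseChanges_le_optCost (hk : 1 ≤ k) (σ : List V) :
    G.phaseChanges k σ ≤ optCost k (σ.map G.label) :=
  le_optCost hk fun _ => phaseChanges_le_faultCount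

end ExtendedAccessGraph

end OnlineAlgorithms

/-! ### Access graphs -/

namespace ExtendedAccessGraph

section Order

variable {V P : Type*} {G : ExtendedAccessGraph V P} {σ : List V} {v u : V} {p q r : P}

theorem IsWalk.exists_walk (hσ : G.IsWalk (v :: σ)) (hu : u ∈ v :: σ) :
    ∃ w : G.graph.Walk v u, w.support ⊆ v :: σ := by
  induction σ generalizing v with
  | nil => exact ⟨.copy .nil rfl (List.mem_singleton.1 hu).symm, by simp⟩
  | cons x σ ih =>
    obtain rfl | hu := List.mem_cons.1 hu
    · exact ⟨.nil, by simp⟩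
    obtain ⟨hvx, hσ⟩ := List.isChain_cons_cons.1 hσ
    obtain ⟨w, hw⟩ := ih hσ hu
    obtain rfl | hadj := hvx
    · exact ⟨w, List.subset_cons_of_subset _ hw⟩
    · exact ⟨.cons hadj w, by simpa using List.subset_cons_of_subset v hw⟩

theorem isWalk_support (w : G.graph.Walk v u) : G.IsWalk w.support :=
  w.isChain_adj_support.imp fun _ _ => Or.inr

/-- There is a path from `v` to `u` on which no vertex has a label in `S`. -/
def ReachableAvoiding (G : ExtendedAccessGraph V P) (v : V) (S : Finset P) (u : V) : Prop :=
  ∃ w : G.graph.Walk v u, ∀ x ∈ w.support, G.label x ∉ S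

theorem precedes_iff :
    G.Precedes v p q ↔ ∀ u, G.ReachableAvoiding v {p} u → G.label u ≠ q := by
  simp only [Precedes, ReachableAvoiding, Finset.mem_singleton]
  constructor
  · rintro h u ⟨w, hw⟩ hu
    obtain ⟨x, hx, hxp⟩ := h u w hu
    exact hw x hx hxp
  · intro h u w hu
    by_contra! hw
    exact h u ⟨w, hw⟩ hu

theorem mem_maximalPages_iff [Fintype P] [DecidableEq P] :
    p ∈ G.maximalPages v ↔ ∀ q ≠ p, ∃ u, G.label u = q ∧ G.ReachableAvoiding v {p} u := by
  simp only [maximalPages, Finset.mem_filter_univ, precedes_iff]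
  refine forall_congr' fun q => ?_
  grind

theorem label_notMem_maximalPages [Fintype P] [DecidableEq P] [Nontrivial P]
    (G : ExtendedAccessGraph V P) (v : V) : G.label v ∉ G.maximalPages v := by
  intro h
  obtain ⟨q, hq⟩ := exists_ne (G.label v)
  obtain ⟨u, -, w, hw⟩ := mem_maximalPages_iff.1 h q hq
  exact hw v w.start_mem_support (Finset.mem_singleton_self _)

theorem precedes_refl (G : ExtendedAccessGraph V P) (v : V) (p : P) : G.Precedes v p p :=
  fun u w hu => ⟨u, w.end_mem_support, hu⟩

namespace Precedes

theorem trans (hpq : G.Precedes v p q) (hqr : G.Precedes v q r) : G.Precedes v p r := by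
  classical
  intro u w hu
  obtain ⟨x, hx, hxq⟩ := hqr u w hu
  obtain ⟨y, hy, hyp⟩ := hpq x (w.takeUntil x hx) hxq
  exact ⟨y, w.support_takeUntil_subset_support hx hy, hyp⟩

-- A shortest path from `v` to a vertex labeled `p` or `q` passes no other such vertex.
theorem antisymm (hpq : G.Precedes v p q) (hqp : G.Precedes v q p) (w : G.graph.Walk v u)
    (hu : G.label u = q) : p = q := by
  classical
  induction hn : w.length using Nat.strong_induction_on generalizing u p q with
  | _ n ih =>
    obtain ⟨x, hx, hxp⟩ := hpq u w hu
    by_cases hxu : x = u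
    · rw [← hxp, hxu, hu]
    · exact (ih _ (hn ▸ SimpleGraph.Walk.length_takeUntil_lt_length hx hxu) hqp hpq
        (w.takeUntil x hx) hxp rfl).symm

end Precedes

/-- The partial order `≺_v` on the pages. Antisymmetry needs that a vertex with each label is
reachable from `v`. -/
@[reducible] def precedesPartialOrder (G : ExtendedAccessGraph V P) (hG : G.graph.Preconnected)
    (hlabel : Function.Surjective G.label) (v : V) : PartialOrder P where
  le := G.Precedes v
  le_refl := G.precedes_refl v
  le_trans _ _ _ := Precedes.trans
  le_antisymm p q hpq hqp := by
    obtain ⟨u, hu⟩ := hlabel q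
    obtain ⟨w⟩ := hG v u
    exact hpq.antisymm hqp w hu

theorem exists_mem_maximalPages_notMem [Fintype P] [DecidableEq P]
    (hG : G.graph.Preconnected) (hlabel : Function.Surjective G.label) {D : Finset P}
    (hD : #D < Fintype.card P) (hclosed : ∀ p q, G.Precedes v p q → q ∈ D → p ∈ D) :
    ∃ p ∈ G.maximalPages v, p ∉ D := by
  let _ := G.precedesPartialOrder hG hlabel v
  obtain ⟨p, hp⟩ := Finset.exists_maximal (s := Dᶜ) (by
    rw [← Finset.card_pos, Finset.card_compl]
    omega)
  have hpD : p ∉ D := Finset.mem_compl.1 hp.prop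
  refine ⟨p, ?_, hpD⟩
  simp only [maximalPages, Finset.mem_filter_univ]
  intro q hpq
  have hq : q ∈ Dᶜ := Finset.mem_compl.2 fun hq => hpD (hclosed p q hpq hq)
  exact (hp.eq_of_le hq hpq).symm

-- The pages on a path from `v` are down-closed for `≺_v`.
theorem exists_mem_maximalPages_notMem_marked [Fintype P] [DecidableEq P] {k : ℕ} (hk : 1 ≤ k)
    (hP : k < Fintype.card P) (hG : G.graph.Preconnected)
    (hlabel : Function.Surjective G.label) (hσ : G.IsWalk σ)
    (hv : (G.currentPhase k σ).head? = some v) :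
    ∃ p ∈ G.maximalPages v, p ∉ G.marked k σ := by
  obtain ⟨τ, hτ⟩ : ∃ τ, G.currentPhase k σ = v :: τ := List.head?_eq_some_iff.1 hv
  have hwalk : G.IsWalk (v :: τ) := hτ ▸ hσ.currentPhase
  refine exists_mem_maximalPages_notMem hG hlabel ((card_marked_le hk σ).trans_lt hP)
    fun p q hpq hq => ?_
  simp only [marked, hτ, List.mem_toFinset, List.mem_map] at hq ⊢
  obtain ⟨u, hu, rfl⟩ := hq
  obtain ⟨w, hw⟩ := hwalk.exists_walk hu
  obtain ⟨x, hx, rfl⟩ := hpq u w rfl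
  exact ⟨x, hw hx, rfl⟩

end Order

section Loops

variable {V P : Type*} {G : ExtendedAccessGraph V P} {σ τ : List V} {v u : V}

/-- The requests `σ` lead from `v` back to `v` (or `σ` is empty). Both the first and the last
request are for `v`, so such sequences can be concatenated. -/
structure LoopAt (G : ExtendedAccessGraph V P) (v : V) (σ : List V) : Prop where
  isWalk : G.IsWalk σ
  head : ∀ x ∈ σ.head?, x = v
  last : ∀ x ∈ σ.getLast?, x = v

namespace LoopAt

theorem nil (G : ExtendedAccessGraph V P) (v : V) : G.LoopAt v [] :=
  ⟨List.isChain_nil, by simp, by simp⟩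

theorem append (hσ : G.LoopAt v σ) (hτ : G.LoopAt v τ) : G.LoopAt v (σ ++ τ) where
  isWalk := List.isChain_append.2 ⟨hσ.isWalk, hτ.isWalk, fun x hx y hy =>
    Or.inl ((hσ.last x hx).trans (hτ.head y hy).symm)⟩
  head x hx := by
    simp only [List.head?_append, Option.mem_def, Option.or_eq_some_iff] at hx
    exact hx.elim (hσ.head x) fun h => hτ.head x h.2
  last x hx := by
    simp only [List.getLast?_append, Option.mem_def, Option.or_eq_some_iff] at hx
    exact hx.elim (hτ.last x) fun h => hσ.last x h.2

theorem support (w : G.graph.Walk v v) : G.LoopAt v w.support where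
  isWalk := isWalk_support w
  head x hx := by
    rw [List.head?_eq_some_head w.support_ne_nil, SimpleGraph.Walk.head_support] at hx
    exact (Option.mem_some_iff.1 hx).symm
  last x hx := by
    rw [List.getLast?_eq_some_getLast w.support_ne_nil, SimpleGraph.Walk.getLast_support] at hx
    exact (Option.mem_some_iff.1 hx).symm

end LoopAt

theorem ReachableAvoiding.exists_loopAt {S : Finset P} (h : G.ReachableAvoiding v S u) :
    ∃ σ, G.LoopAt v σ ∧ (∀ x ∈ σ, G.label x ∉ S) ∧ u ∈ σ := by
  obtain ⟨w, hw⟩ := h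
  refine ⟨(w.append w.reverse).support, .support _, fun x hx => hw x ?_, ?_⟩
  · simpa using hx
  · simp

theorem exists_loopAt_avoiding [Finite P] (G : ExtendedAccessGraph V P) (v : V) (S : Finset P) :
    ∃ σ, G.LoopAt v σ ∧ (∀ x ∈ σ, G.label x ∉ S) ∧
      ∀ u, G.ReachableAvoiding v S u → G.label u ∈ σ.map G.label := by
  classical
  have := Fintype.ofFinite P
  suffices hsuff : ∀ F : Finset P, ∃ σ, G.LoopAt v σ ∧ (∀ x ∈ σ, G.label x ∉ S) ∧
      ∀ u, G.ReachableAvoiding v S u → G.label u ∈ F → G.label u ∈ σ.map G.label by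
    simpa using hsuff Finset.univ
  intro F
  induction F using Finset.induction_on with
  | empty => exact ⟨[], .nil G v, by simp, by simp⟩
  | insert p F _ ih =>
    obtain ⟨σ, hloop, havoid, hcover⟩ := ih
    by_cases hp : ∃ u, G.ReachableAvoiding v S u ∧ G.label u = p
    · obtain ⟨y, hy, rfl⟩ := hp
      obtain ⟨τ, hloop', havoid', hyτ⟩ := hy.exists_loopAt
      refine ⟨σ ++ τ, hloop.append hloop', fun x hx => ?_, fun u hu huF => ?_⟩
      · exact (List.mem_append.1 hx).elim (havoid x) (havoid' x)
      · rw [List.map_append, List.mem_append]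
        obtain huy | huF := Finset.mem_insert.1 huF
        · exact Or.inr (huy ▸ List.mem_map_of_mem hyτ)
        · exact Or.inl (hcover u hu huF)
    · refine ⟨σ, hloop, havoid, fun u hu huF => hcover u hu ?_⟩
      exact (Finset.mem_insert.1 huF).resolve_left fun h => hp ⟨u, hu, h⟩

theorem exists_loopAt_le_optCost [Fintype P] [DecidableEq P] {k : ℕ} (hk : 1 ≤ k)
    (hP : k < Fintype.card P) (hG : G.graph.Preconnected)
    (hlabel : Function.Surjective G.label) (v : V) (T : ℕ) :
    ∃ σ, G.LoopAt v σ ∧ T ≤ optCost k (σ.map G.label) := by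
  obtain ⟨σ₀, hloop₀, -, hcover⟩ := G.exists_loopAt_avoiding v ∅
  have hall (p : P) : p ∈ σ₀.map G.label := by
    obtain ⟨u, rfl⟩ := hlabel p
    obtain ⟨w⟩ := hG v u
    exact hcover u ⟨w, by simp⟩
  suffices hsuff : ∃ σ, G.LoopAt v σ ∧
      ∀ C, IsService k (σ.map G.label) C → T ≤ faultCount (σ.map G.label) C by
    obtain ⟨σ, hloop, hfaults⟩ := hsuff
    exact ⟨σ, hloop, le_optCost hk hfaults⟩
  induction T with
  | zero => exact ⟨[], .nil G v, by simp⟩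
  | succ T ih =>
    obtain ⟨σ, hloop, hfaults⟩ := ih
    refine ⟨σ ++ σ₀, hloop.append hloop₀, fun C hC => ?_⟩
    rw [List.map_append] at hC ⊢
    obtain ⟨p, -, hp⟩ := Finset.exists_mem_notMem_of_card_lt_card
      (hC.of_append.card_le.trans_lt (hP.trans_eq Finset.card_univ.symm))
    exact (hfaults C hC.of_append).trans_lt (hC.faultCount_lt_append hp (hall p))

end Loops

end ExtendedAccessGraph

/-! ### Randomized algorithms -/

section Randomized

variable {V P : Type*} [DecidableEq P] {G : ExtendedAccessGraph V P} {k : ℕ}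

namespace OnlineAlg

theorem measurableSet_mem_serve (p : P) (σ : List V) :
    MeasurableSet {A : OnlineAlg G k | p ∈ A.serve σ} :=
  le_iSup (fun σ : List V =>
    MeasurableSpace.comap (fun A : OnlineAlg G k => A.serve σ) ⊤) σ _ ⟨{S | p ∈ S}, trivial, rfl⟩

theorem measurable_faults (σ : List V) :
    Measurable fun A : OnlineAlg G k => (A.faults σ : ℝ≥0∞) := by
  induction σ using List.reverseRecOn with
  | nil => simp
  | append_singleton σ v ih =>
    simp only [faults_append_singleton, Nat.cast_add, Nat.cast_ite]
    exact ih.add (.ite (measurableSet_mem_serve _ _) measurable_const measurable_const)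

end OnlineAlg

theorem optCost_le_expectedFaults (μ : MeasureTheory.ProbabilityMeasure (OnlineAlg G k))
    (σ : List V) : (optCost k (σ.map G.label) : ℝ≥0∞) ≤ expectedFaults μ σ := by
  calc (optCost k (σ.map G.label) : ℝ≥0∞)
      = ∫⁻ _, (optCost k (σ.map G.label) : ℝ≥0∞)
          ∂(μ : MeasureTheory.Measure (OnlineAlg G k)) := by simp
    _ ≤ expectedFaults μ σ :=
        MeasureTheory.lintegral_mono fun A => Nat.cast_le.2 (A.optCost_le_faults σ)

theorem le_asymptoticRatio {μ : MeasureTheory.ProbabilityMeasure (OnlineAlg G k)} {a : ℝ≥0}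
    {b : ℕ} (h : ∀ T : ℕ, ∃ σ, G.IsWalk σ ∧ ∃ n ≥ T, optCost k (σ.map G.label) ≤ n + b ∧
      (a * n : ℝ≥0∞) ≤ expectedFaults μ σ) : (a : ℝ≥0∞) ≤ asymptoticRatio μ := by
  refine le_sInf ?_
  rintro r ⟨C, hC⟩
  by_contra! hr
  lift r to ℝ≥0 using hr.ne_top
  have hr : (r : ℝ) < a := by exact_mod_cast hr
  obtain ⟨T, hT⟩ := exists_nat_gt ((r * b + C : ℝ) / (a - r))
  obtain ⟨σ, hσ, n, hn, hopt, hfaults⟩ := h T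
  have hle : (a * n : ℝ≥0∞) ≤ r * (n + b : ℕ) + C := by
    refine hfaults.trans ((hC σ hσ).trans ?_)
    gcongr
  have hle : (a * n : ℝ) ≤ r * (n + b) + C := by exact_mod_cast hle
  have hn : (T : ℝ) ≤ n := by exact_mod_cast hn
  rw [div_lt_iff₀ (sub_pos.2 hr)] at hT
  have := mul_le_mul_of_nonneg_right hn (sub_pos.2 hr).le
  linarith

namespace ExtendedAccessGraph

theorem one_le_rOblAsymp [Fintype P] (hk : 1 ≤ k) (hP : k < Fintype.card P)
    (hG : G.graph.Preconnected) (hlabel : Function.Surjective G.label) : 1 ≤ G.rOblAsymp k := by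
  have : Nonempty P := Fintype.card_pos_iff.1 (by omega)
  obtain ⟨v, -⟩ := hlabel (Classical.arbitrary P)
  refine le_iInf fun μ => ENNReal.coe_one ▸ le_asymptoticRatio (b := 0) fun T => ?_
  obtain ⟨σ, hloop, hT⟩ := exists_loopAt_le_optCost hk hP hG hlabel v T
  refine ⟨σ, hloop.isWalk, _, hT, le_rfl, ?_⟩
  simpa using optCost_le_expectedFaults μ σ

theorem rOblAsymp_le_rOblAsympPages (G : ExtendedAccessGraph V P) (k : ℕ) :
    G.rOblAsymp k ≤ G.rOblAsympPages k :=
  le_iInf fun μ => iInf_le _ μ.1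

end ExtendedAccessGraph

end Randomized

/-! ### The adversary -/

section Adversary

variable {V P : Type*} [DecidableEq P] {G : ExtendedAccessGraph V P} {k d : ℕ} {v : V}
  {S S₁ S₂ : Finset P} {W W₁ W₂ : P → List V}

namespace OnlineAlg

theorem two_mul_faults_lt_add [Fintype P] (hP : k < Fintype.card P) (A : OnlineAlg G k)
    (τ : List V) {σ₁ σ₂ : List V} (hcover : ∀ p, p ∈ σ₁.map G.label ∨ p ∈ σ₂.map G.label) :
    2 * A.faults τ < A.faults (τ ++ σ₁) + A.faults (τ ++ σ₂) := by
  obtain ⟨p, -, hp⟩ := Finset.exists_mem_notMem_of_card_lt_card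
    ((A.card_serve_le τ).trans_lt (hP.trans_eq Finset.card_univ.symm))
  have hle₁ := A.faults_le_append τ σ₁
  have hle₂ := A.faults_le_append τ σ₂
  rcases hcover p with hpσ | hpσ <;> have := A.faults_lt_append hp hpσ <;> omega

end OnlineAlg

namespace ExtendedAccessGraph

/-- One round of the adversary, who draws `p ∈ S` uniformly at random and requests `W p`. This is a
loop at `v` that avoids `p`, and whatever was requested before, every deterministic algorithm has
at least `d / 2` faults on average. -/
structure IsHardRound (G : ExtendedAccessGraph V P) (k : ℕ) (v : V) (d : ℕ) (S : Finset P)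
    (W : P → List V) : Prop where
  loopAt : ∀ p ∈ S, G.LoopAt v (W p)
  notMem : ∀ p ∈ S, p ∉ (W p).map G.label
  le_sum_faults : ∀ (A : OnlineAlg G k) (τ : List V),
    #S * (2 * A.faults τ + d) ≤ 2 * ∑ p ∈ S, A.faults (τ ++ W p)

namespace IsHardRound

theorem singleton (G : ExtendedAccessGraph V P) (k : ℕ) (v : V) (p : P) :
    G.IsHardRound k v 0 {p} fun _ => [] where
  loopAt _ _ := .nil G v
  notMem _ _ := by simp
  le_sum_faults A τ := by simp

-- The adversary first tours the pages reachable while avoiding the half that contains `p`. The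
-- page missing from the memory is on the tour of `S₁` or on the tour of `S₂`.
theorem union [Fintype P] (hP : k < Fintype.card P) (h₁ : G.IsHardRound k v d S₁ W₁)
    (h₂ : G.IsHardRound k v d S₂ W₂) (hcard : #S₁ = #S₂) (hdisj : Disjoint S₁ S₂)
    (hreach : ∀ p, ∃ u, G.label u = p ∧
      (G.ReachableAvoiding v S₁ u ∨ G.ReachableAvoiding v S₂ u)) :
    ∃ W, G.IsHardRound k v (d + 1) (S₁ ∪ S₂) W := by
  obtain ⟨σ₁, hloop₁, havoid₁, hcover₁⟩ := G.exists_loopAt_avoiding v S₁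
  obtain ⟨σ₂, hloop₂, havoid₂, hcover₂⟩ := G.exists_loopAt_avoiding v S₂
  let W (p : P) : List V := if p ∈ S₁ then σ₁ ++ W₁ p else σ₂ ++ W₂ p
  have hW₁ : ∀ p ∈ S₁, W p = σ₁ ++ W₁ p := fun p hp => if_pos hp
  have hW₂ : ∀ p ∈ S₂, W p = σ₂ ++ W₂ p := fun p hp => if_neg (Finset.disjoint_right.1 hdisj hp)
  refine ⟨W, fun p hp => ?_, fun p hp => ?_, fun A τ => ?_⟩
  · rcases Finset.mem_union.1 hp with hp | hp
    · exact hW₁ p hp ▸ hloop₁.append (h₁.loopAt p hp)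
    · exact hW₂ p hp ▸ hloop₂.append (h₂.loopAt p hp)
  · rcases Finset.mem_union.1 hp with hp | hp
    · have := h₁.notMem p hp
      grind
    · have := h₂.notMem p hp
      grind
  · have hcover (p : P) : p ∈ σ₁.map G.label ∨ p ∈ σ₂.map G.label := by
      obtain ⟨u, rfl, hu⟩ := hreach p
      exact hu.imp (hcover₁ u) (hcover₂ u)
    have hfaults := A.two_mul_faults_lt_add hP τ hcover
    calc #(S₁ ∪ S₂) * (2 * A.faults τ + (d + 1))
        = #S₁ * (2 * (2 * A.faults τ + 1) + 2 * d) := by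
          rw [Finset.card_union_of_disjoint hdisj, ← hcard]
          ring
      _ ≤ #S₁ * (2 * (A.faults (τ ++ σ₁) + A.faults (τ ++ σ₂)) + 2 * d) := by
          refine Nat.mul_le_mul_left _ ?_
          omega
      _ = #S₁ * (2 * A.faults (τ ++ σ₁) + d) + #S₂ * (2 * A.faults (τ ++ σ₂) + d) := by
          rw [← hcard]
          ring
      _ ≤ 2 * ∑ p ∈ S₁, A.faults (τ ++ σ₁ ++ W₁ p) + 2 * ∑ p ∈ S₂, A.faults (τ ++ σ₂ ++ W₂ p) :=
          add_le_add (h₁.le_sum_faults A _) (h₂.le_sum_faults A _)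
      _ = 2 * ∑ p ∈ S₁ ∪ S₂, A.faults (τ ++ W p) := by
          rw [Finset.sum_union hdisj, mul_add]
          congr 2 <;> refine Finset.sum_congr rfl fun p hp => ?_
          · rw [hW₁ p hp, List.append_assoc]
          · rw [hW₂ p hp, List.append_assoc]

theorem le_sum_expectedFaults (h : G.IsHardRound k v d S W)
    (μ : MeasureTheory.ProbabilityMeasure (OnlineAlg G k)) (τ : List V) :
    #S * (2 * expectedFaults μ τ + d) ≤ 2 * ∑ p ∈ S, expectedFaults μ (τ ++ W p) := by
  have hmeas (σ : List V) := OnlineAlg.measurable_faults (G := G) (k := k) σ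
  have hmeas' : Measurable fun A : OnlineAlg G k => 2 * (A.faults τ : ℝ≥0∞) + d :=
    ((hmeas τ).const_mul 2).add measurable_const
  calc #S * (2 * expectedFaults μ τ + d)
      = ∫⁻ A, #S * (2 * (A.faults τ : ℝ≥0∞) + d)
          ∂(μ : MeasureTheory.Measure (OnlineAlg G k)) := by
        rw [MeasureTheory.lintegral_const_mul _ hmeas',
          MeasureTheory.lintegral_add_right _ measurable_const,
          MeasureTheory.lintegral_const_mul _ (hmeas τ)]
        simp [expectedFaults]
    _ ≤ ∫⁻ A, 2 * ∑ p ∈ S, (A.faults (τ ++ W p) : ℝ≥0∞)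
          ∂(μ : MeasureTheory.Measure (OnlineAlg G k)) :=
        MeasureTheory.lintegral_mono fun A => by
          beta_reduce
          exact_mod_cast h.le_sum_faults A τ
    _ = 2 * ∑ p ∈ S, expectedFaults μ (τ ++ W p) := by
        rw [MeasureTheory.lintegral_const_mul _ (Finset.measurable_fun_sum _ fun p _ => hmeas _),
          MeasureTheory.lintegral_finsetSum _ fun p _ => hmeas _]
        rfl

theorem exists_le_expectedFaults (h : G.IsHardRound k v d S W) (hS : S.Nonempty)
    (μ : MeasureTheory.ProbabilityMeasure (OnlineAlg G k)) (τ : List V) :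
    ∃ p ∈ S, 2 * expectedFaults μ τ + d ≤ 2 * expectedFaults μ (τ ++ W p) := by
  by_contra! hlt
  refine (h.le_sum_expectedFaults μ τ).not_gt ?_
  rw [Finset.mul_sum, ← nsmul_eq_mul, ← Finset.sum_const]
  exact ENNReal.sum_lt_sum_of_nonempty hS hlt

theorem exists_loopAt_le_expectedFaults [Fintype P] (h : G.IsHardRound k v d S W)
    (hS : S.Nonempty) (hP : Fintype.card P ≤ k + 1)
    (μ : MeasureTheory.ProbabilityMeasure (OnlineAlg G k)) (T : ℕ) :
    ∃ σ, G.LoopAt v σ ∧ optCost k (σ.map G.label) ≤ T + k ∧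
      (d * T : ℝ≥0∞) ≤ 2 * expectedFaults μ σ := by
  suffices hsuff : ∃ L : List (List V), L.length = T ∧ G.LoopAt v L.flatten ∧
      (∀ σ ∈ L, ∃ p, p ∉ σ.map G.label) ∧ (d * T : ℝ≥0∞) ≤ 2 * expectedFaults μ L.flatten by
    obtain ⟨L, rfl, hloop, havoid, hfaults⟩ := hsuff
    refine ⟨L.flatten, hloop, ?_, hfaults⟩
    rw [List.map_flatten]
    refine (optCost_flatten_le hP _ fun τ hτ => ?_).trans_eq (by rw [List.length_map])
    obtain ⟨σ, hσ, rfl⟩ := List.mem_map.1 hτ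
    exact havoid σ hσ
  induction T with
  | zero => exact ⟨[], rfl, .nil G v, by simp, by simp⟩
  | succ T ih =>
    obtain ⟨L, rfl, hloop, havoid, hfaults⟩ := ih
    obtain ⟨p, hp, hle⟩ := h.exists_le_expectedFaults hS μ L.flatten
    refine ⟨L ++ [W p], by simp, ?_, ?_, ?_⟩
    · simpa using hloop.append (h.loopAt p hp)
    · exact List.forall_mem_append.2 ⟨havoid, by simpa using ⟨p, by simpa using h.notMem p hp⟩⟩
    · rw [List.flatten_append, List.flatten_singleton, Nat.cast_add_one, mul_add, mul_one]
      exact (add_le_add_left hfaults _).trans hle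

theorem le_two_mul_rOblAsymp [Fintype P] (h : G.IsHardRound k v d S W) (hS : S.Nonempty)
    (hP : Fintype.card P ≤ k + 1) : (d : ℝ≥0∞) ≤ 2 * G.rOblAsymp k := by
  have hhalf : ((d / 2 : ℝ≥0) : ℝ≥0∞) ≤ G.rOblAsymp k := by
    refine le_iInf fun μ => le_asymptoticRatio (b := k) fun T => ?_
    obtain ⟨σ, hloop, hopt, hfaults⟩ := h.exists_loopAt_le_expectedFaults hS hP μ T
    refine ⟨σ, hloop.isWalk, T, le_rfl, hopt, ?_⟩
    rw [ENNReal.coe_div two_ne_zero, ENNReal.mul_comm_div, ← mul_div_assoc]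
    exact ENNReal.div_le_of_le_mul' (by simpa using hfaults)
  rw [ENNReal.coe_div two_ne_zero] at hhalf
  simpa using (ENNReal.div_le_iff' (by simp) (by simp)).1 hhalf

end IsHardRound

end ExtendedAccessGraph

end Adversary

/-! ### Paths -/

section PathGeometry

open SimpleGraph

variable {m : ℕ} {P : Type*} {ℓ : Fin m → P} {i u x : Fin m} {p q r : P}

theorem mem_support_of_mem_uIcc (w : (pathGraph m).Walk i u) (hx : x ∈ Set.uIcc i u) :
    x ∈ w.support := by
  induction w with
  | nil => simpa using hx
  | @cons i j u hadj w ih =>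
    rw [Walk.support_cons, List.mem_cons, or_iff_not_imp_left]
    intro hne
    refine ih ?_
    rw [pathGraph_adj] at hadj
    rw [Set.mem_uIcc] at hx ⊢
    omega

theorem exists_walk_support_subset_Icc (h : i ≤ u) :
    ∃ w : (pathGraph m).Walk i u, ∀ x ∈ w.support, x ∈ Set.Icc i u := by
  obtain ⟨d, hd⟩ : ∃ d : ℕ, (u : ℕ) = i + d := Nat.exists_eq_add_of_le h
  induction d generalizing u with
  | zero =>
    obtain rfl : u = i := Fin.ext hd
    exact ⟨.nil, by simp⟩
  | succ d ih =>
    obtain ⟨w, hw⟩ := ih (u := ⟨i + d, by omega⟩) (Fin.le_def.2 (by simp)) rfl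
    have hadj : (pathGraph m).Adj ⟨i + d, by omega⟩ u := pathGraph_adj.2 (Or.inl hd.symm)
    refine ⟨w.concat hadj, fun x hx => ?_⟩
    rw [Walk.support_concat, List.mem_append, List.mem_singleton] at hx
    obtain hx | rfl := hx
    · obtain ⟨hix, hxu⟩ := hw x hx
      exact ⟨hix, hxu.trans (Fin.le_def.2 (by simp [hd]))⟩
    · exact ⟨h, le_rfl⟩

theorem exists_walk_support_subset_uIcc (i u : Fin m) :
    ∃ w : (pathGraph m).Walk i u, ∀ x ∈ w.support, x ∈ Set.uIcc i u := by
  rcases le_total i u with h | h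
  · obtain ⟨w, hw⟩ := exists_walk_support_subset_Icc h
    exact ⟨w, fun x hx => Set.Icc_subset_uIcc (hw x hx)⟩
  · obtain ⟨w, hw⟩ := exists_walk_support_subset_Icc h
    exact ⟨w.reverse, fun x hx => Set.Icc_subset_uIcc' (hw x (by simpa using hx))⟩

theorem reachableAvoiding_pathEAG_iff {S : Finset P} :
    (pathEAG ℓ).ReachableAvoiding i S u ↔ ∀ p ∈ S, p ∉ ℓ '' Set.uIcc i u := by
  constructor
  · rintro ⟨w, hw⟩ _ hp ⟨x, hx, rfl⟩
    exact hw x (mem_support_of_mem_uIcc w hx) hp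
  · intro h
    obtain ⟨w, hw⟩ := exists_walk_support_subset_uIcc i u
    exact ⟨w, fun x hx hS => h _ hS ⟨x, hw x hx, rfl⟩⟩

theorem ExtendedAccessGraph.IsWalk.uIcc_subset {σ : List (Fin m)}
    (hσ : (pathEAG ℓ).IsWalk (i :: σ)) (hu : u ∈ i :: σ) : ∀ x ∈ Set.uIcc i u, x ∈ i :: σ := by
  obtain ⟨w, hw⟩ := hσ.exists_walk hu
  exact fun x hx => hw (mem_support_of_mem_uIcc w hx)

theorem mem_maximalPages_pathEAG_iff [Fintype P] [DecidableEq P] :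
    p ∈ (pathEAG ℓ).maximalPages i ↔ ∀ q ≠ p, ∃ u, ℓ u = q ∧ p ∉ ℓ '' Set.uIcc i u := by
  simp only [ExtendedAccessGraph.mem_maximalPages_iff, reachableAvoiding_pathEAG_iff,
    Finset.mem_singleton, forall_eq]
  rfl

theorem not_leftBefore_self (ℓ : Fin m → P) (i : Fin m) (p : P) : ¬LeftBefore ℓ i p p :=
  fun ⟨a, hai, hap, hclear⟩ => hclear a le_rfl hai hap

theorem LeftBefore.trans (hpq : LeftBefore ℓ i p q) (hqr : LeftBefore ℓ i q r) :
    LeftBefore ℓ i p r := by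
  obtain ⟨a, hai, hap, ha⟩ := hpq
  obtain ⟨b, hbi, hbq, hb⟩ := hqr
  have hba : b ≤ a := by
    by_contra! hab
    exact ha b hab.le hbi hbq
  exact ⟨a, hai, hap, fun x hx => hb x (hba.trans hx)⟩

theorem LeftBefore.notMem_image_uIcc_left [Fintype P] [DecidableEq P] [Nontrivial P]
    (hpq : LeftBefore ℓ i p q) (hq : q ∈ (pathEAG ℓ).maximalPages i) (hu : u ≤ i)
    (hp : p ∉ ℓ '' Set.uIcc i u) : q ∉ ℓ '' Set.uIcc i u := by
  rintro ⟨x, hx, rfl⟩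
  obtain ⟨a, hai, hap, ha⟩ := hpq
  rw [Set.uIcc_of_ge hu] at hx hp
  have hxi : x ≠ i := by
    rintro rfl
    exact (pathEAG ℓ).label_notMem_maximalPages x hq
  have hxa : x < a := by
    by_contra! hax
    exact ha x hax (hx.2.lt_of_ne hxi) rfl
  exact hp ⟨a, ⟨hx.1.trans hxa.le, hai.le⟩, hap⟩

variable [Fintype P] [DecidableEq P]

theorem leftBefore_or_leftBefore (hp : p ∈ (pathEAG ℓ).maximalPages i)
    (hq : q ∈ (pathEAG ℓ).maximalPages i) (hne : p ≠ q) :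
    LeftBefore ℓ i p q ∨ LeftBefore ℓ i q p := by
  obtain ⟨u, huq, hu⟩ := mem_maximalPages_pathEAG_iff.1 hp q hne.symm
  obtain ⟨v, hvp, hv⟩ := mem_maximalPages_pathEAG_iff.1 hq p hne
  rcases lt_or_ge u i with hui | hiu
  · exact Or.inr ⟨u, hui, huq, fun b hub hbi hbp =>
      hu ⟨b, Set.Icc_subset_uIcc' ⟨hub, hbi.le⟩, hbp⟩⟩
  rcases lt_or_ge v i with hvi | hiv
  · exact Or.inl ⟨v, hvi, hvp, fun b hvb hbi hbq =>
      hv ⟨b, Set.Icc_subset_uIcc' ⟨hvb, hbi.le⟩, hbq⟩⟩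
  rcases le_total u v with huv | hvu
  · exact (hv ⟨u, Set.Icc_subset_uIcc ⟨hiu, huv⟩, huq⟩).elim
  · exact (hu ⟨v, Set.Icc_subset_uIcc ⟨hiv, hvu⟩, hvp⟩).elim

namespace LeftBefore

theorem exists_right (hpq : LeftBefore ℓ i p q) (hp : p ∈ (pathEAG ℓ).maximalPages i) :
    ∃ u ≥ i, ℓ u = q ∧ p ∉ ℓ '' Set.uIcc i u := by
  obtain ⟨a, hai, hap, ha⟩ := hpq
  obtain ⟨u, huq, hu⟩ := mem_maximalPages_pathEAG_iff.1 hp q fun hqp =>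
    ha a le_rfl hai (hap.trans hqp.symm)
  refine ⟨u, ?_, huq, hu⟩
  by_contra! hui
  have hua : u ≤ a := by
    by_contra! hau
    exact ha u hau.le hui huq
  exact hu ⟨a, Set.Icc_subset_uIcc' ⟨hua, hai.le⟩, hap⟩

theorem notMem_image_uIcc_right (hpq : LeftBefore ℓ i p q)
    (hp : p ∈ (pathEAG ℓ).maximalPages i) (hu : i ≤ u) (hq : q ∉ ℓ '' Set.uIcc i u) :
    p ∉ ℓ '' Set.uIcc i u := by
  obtain ⟨v, hiv, hvq, hv⟩ := hpq.exists_right hp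
  have huv : u < v := by
    by_contra! hvu
    exact hq ⟨v, Set.Icc_subset_uIcc ⟨hiv, hvu⟩, hvq⟩
  rintro ⟨x, hx, hxp⟩
  rw [Set.uIcc_of_le hu] at hx
  exact hv ⟨x, Set.Icc_subset_uIcc ⟨hx.1, hx.2.trans huv.le⟩, hxp⟩

end LeftBefore

open scoped Classical in
theorem card_maximalPages_filter_not_onBothSides_le (ℓ : Fin m → P) (i : Fin m) :
    #{p ∈ (pathEAG ℓ).maximalPages i | ¬OnBothSides ℓ i p} ≤ 2 := by
  set M := (pathEAG ℓ).maximalPages i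
  have hleft : #{p ∈ M | ¬∃ a, a < i ∧ ℓ a = p} ≤ 1 := by
    refine Finset.card_le_one.2 fun p hp q hq => ?_
    rw [Finset.mem_filter] at hp hq
    by_contra hne
    obtain ⟨a, hai, hap, -⟩ | ⟨a, hai, haq, -⟩ := leftBefore_or_leftBefore hp.1 hq.1 hne
    · exact hp.2 ⟨a, hai, hap⟩
    · exact hq.2 ⟨a, hai, haq⟩
  have hmeet {p q : P} (hpq : LeftBefore ℓ i p q) (hp : p ∈ M) (hq : q ∈ M) :
      ∃ b, i < b ∧ ℓ b = q := by
    have : Nontrivial P := ⟨p, q, fun h => not_leftBefore_self ℓ i p (h ▸ hpq)⟩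
    obtain ⟨b, hib, rfl, -⟩ := hpq.exists_right hp
    refine ⟨b, hib.lt_of_ne ?_, rfl⟩
    rintro rfl
    exact (pathEAG ℓ).label_notMem_maximalPages i hq
  have hright : #{p ∈ M | ¬∃ b, i < b ∧ ℓ b = p} ≤ 1 := by
    refine Finset.card_le_one.2 fun p hp q hq => ?_
    rw [Finset.mem_filter] at hp hq
    by_contra hne
    obtain h | h := leftBefore_or_leftBefore hp.1 hq.1 hne
    · exact hq.2 (hmeet h hp.1 hq.1)
    · exact hp.2 (hmeet h hq.1 hp.1)
  calc #{p ∈ M | ¬OnBothSides ℓ i p}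
      = #({p ∈ M | ¬∃ a, a < i ∧ ℓ a = p} ∪ {p ∈ M | ¬∃ b, i < b ∧ ℓ b = p}) := by
        simp only [OnBothSides, not_and_or, Finset.filter_or]
    _ ≤ 2 := (Finset.card_union_le _ _).trans (add_le_add hleft hright)

end PathGeometry

/-! ### The lower bound -/

theorem exists_card_filter_eq {α : Type*} {r : α → α → Prop} [DecidableRel r] {X : Finset α}
    {t : ℕ} (hirrefl : ∀ a ∈ X, ¬r a a) (htrans : ∀ a ∈ X, ∀ b ∈ X, ∀ c ∈ X, r a b → r b c → r a c)
    (htotal : ∀ a ∈ X, ∀ b ∈ X, a ≠ b → r a b ∨ r b a) (ht : t < #X) :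
    ∃ b ∈ X, #{a ∈ X | r a b} = t := by
  have hlt : ∀ a ∈ X, ∀ b ∈ X, r a b → #{c ∈ X | r c a} < #{c ∈ X | r c b} := by
    intro a ha b hb hab
    refine Finset.card_lt_card ((Finset.ssubset_iff_of_subset fun c hc => ?_).2 ⟨a, ?_, ?_⟩)
    · obtain ⟨hc, hca⟩ := Finset.mem_filter.1 hc
      exact Finset.mem_filter.2 ⟨hc, htrans c hc a ha b hb hca hab⟩
    · exact Finset.mem_filter.2 ⟨ha, hab⟩
    · exact fun h => hirrefl a ha (Finset.mem_filter.1 h).2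
  have hmaps : ∀ b ∈ X, #{a ∈ X | r a b} ∈ Finset.range #X := fun b hb =>
    Finset.mem_range.2 <| Finset.card_lt_card <|
      Finset.filter_ssubset.2 ⟨b, hb, hirrefl b hb⟩
  have hinj : Set.InjOn (fun b => #{a ∈ X | r a b}) X := by
    intro a ha b hb hab
    by_contra hne
    rcases htotal a ha b hb hne with h | h
    · exact (hlt a ha b hb h).ne hab
    · exact (hlt b hb a ha h).ne' hab
  obtain ⟨b, hb, hbt⟩ := Finset.surjOn_of_injOn_of_card_le _ hmaps hinj
    (Finset.card_range _).le (Finset.mem_coe.2 (Finset.mem_range.2 ht))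
  exact ⟨b, hb, hbt⟩

section LowerBound

variable {m : ℕ} {P : Type*} [Fintype P] [DecidableEq P] {ℓ : Fin m → P} {i : Fin m} {k : ℕ}
  {S S₁ S₂ : Finset P} {q : P}

open scoped Classical in
theorem exists_card_leftBefore_eq (hS : S ⊆ (pathEAG ℓ).maximalPages i) {t : ℕ} (ht : t < #S) :
    ∃ q ∈ S, #{p ∈ S | LeftBefore ℓ i p q} = t :=
  exists_card_filter_eq (fun p _ => not_leftBefore_self ℓ i p)
    (fun _ _ _ _ _ _ => LeftBefore.trans)
    (fun _ hp _ hq => leftBefore_or_leftBefore (hS hp) (hS hq)) ht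

-- A vertex to the left of `i` that is reached avoiding `q` is reached avoiding `S₂`, and one to
-- the right is reached avoiding `S₁`. The first `q` to the right of `i` is met before all of `S₁`.
theorem exists_reachableAvoiding_or [Nontrivial P] (hS₁ : S₁ ⊆ (pathEAG ℓ).maximalPages i)
    (hS₂ : S₂ ⊆ (pathEAG ℓ).maximalPages i) (hne : S₁.Nonempty) (hq : q ∈ S₂)
    (h₁ : ∀ p ∈ S₁, LeftBefore ℓ i p q) (h₂ : ∀ p ∈ S₂, p = q ∨ LeftBefore ℓ i q p) (p : P) :
    ∃ u, ℓ u = p ∧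
      ((pathEAG ℓ).ReachableAvoiding i S₁ u ∨ (pathEAG ℓ).ReachableAvoiding i S₂ u) := by
  simp only [reachableAvoiding_pathEAG_iff]
  by_cases hpq : p = q
  · subst hpq
    obtain ⟨r, hr⟩ := hne
    obtain ⟨v, hiv, hvp, -⟩ := (h₁ r hr).exists_right (hS₁ hr)
    obtain ⟨u, ⟨hiu, hu⟩, hmin⟩ :=
      Set.exists_min_image {u | i ≤ u ∧ ℓ u = p} id (Set.toFinite _) ⟨v, hiv, hvp⟩
    refine ⟨u, hu, Or.inl fun r hr hru => ?_⟩
    obtain ⟨v, hiv, hvp, hv⟩ := (h₁ r hr).exists_right (hS₁ hr)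
    refine hv (Set.image_mono (Set.uIcc_subset_uIcc_left ?_) hru)
    exact Set.Icc_subset_uIcc ⟨hiu, hmin v ⟨hiv, hvp⟩⟩
  · obtain ⟨u, hu, hqu⟩ := mem_maximalPages_pathEAG_iff.1 (hS₂ hq) p hpq
    refine ⟨u, hu, ?_⟩
    rcases le_total i u with hiu | hui
    · exact Or.inl fun r hr => (h₁ r hr).notMem_image_uIcc_right (hS₁ hr) hiu hqu
    · refine Or.inr fun r hr => ?_
      obtain rfl | hqr := h₂ r hr
      · exact hqu
      · exact hqr.notMem_image_uIcc_left (hS₂ hr) hui hqu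

theorem exists_isHardRound (hk : 1 ≤ k) (hP : k < Fintype.card P) {d : ℕ}
    (hS : S ⊆ (pathEAG ℓ).maximalPages i) (hd : #S = 2 ^ d) :
    ∃ W, (pathEAG ℓ).IsHardRound k i d S W := by
  classical
  have : Nontrivial P := Fintype.one_lt_card_iff_nontrivial.1 (by omega)
  induction d generalizing S with
  | zero =>
    obtain ⟨p, rfl⟩ := Finset.card_eq_one.1 hd
    exact ⟨_, .singleton _ k i p⟩
  | succ d ih =>
    have hpow := Nat.two_pow_pos d
    rw [pow_succ] at hd
    obtain ⟨q, hq, hcard₁⟩ := exists_card_leftBefore_eq (t := 2 ^ d) hS (by omega)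
    set S₁ := {p ∈ S | LeftBefore ℓ i p q}
    set S₂ := {p ∈ S | ¬LeftBefore ℓ i p q}
    have hunion : S₁ ∪ S₂ = S := Finset.filter_union_filter_not_eq _ S
    have hdisj : Disjoint S₁ S₂ := Finset.disjoint_filter_filter_not _ _ _
    have hcard₂ : #S₂ = 2 ^ d := by
      rw [← hunion, Finset.card_union_of_disjoint hdisj] at hd
      omega
    have hS₁ : S₁ ⊆ (pathEAG ℓ).maximalPages i := (S.filter_subset _).trans hS
    have hS₂ : S₂ ⊆ (pathEAG ℓ).maximalPages i := (S.filter_subset _).trans hS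
    have hq₂ : q ∈ S₂ := Finset.mem_filter.2 ⟨hq, not_leftBefore_self ℓ i q⟩
    have hbefore (p : P) (hp : p ∈ S₂) : p = q ∨ LeftBefore ℓ i q p :=
      or_iff_not_imp_left.2 fun hne => (leftBefore_or_leftBefore (hS₂ hp) (hS hq) hne).resolve_left
        (Finset.mem_filter.1 hp).2
    obtain ⟨W₁, h₁⟩ := ih hS₁ hcard₁
    obtain ⟨W₂, h₂⟩ := ih hS₂ hcard₂
    rw [← hunion]
    exact h₁.union hP h₂ (hcard₁.trans hcard₂.symm) hdisj <|
      exists_reachableAvoiding_or hS₁ hS₂ (Finset.card_pos.1 (by omega)) hq₂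
        (fun p hp => (Finset.mem_filter.1 hp).2) hbefore

theorem log_le_natLog_two_add_one (n : ℕ) : Real.log n ≤ Nat.log 2 n + 1 := by
  rcases n.eq_zero_or_pos with rfl | hn
  · simp
  · calc Real.log n ≤ Real.log (2 ^ (Nat.log 2 n + 1)) :=
          Real.log_le_log (by exact_mod_cast hn)
            (by exact_mod_cast (Nat.lt_pow_succ_log_self one_lt_two n).le)
      _ = (Nat.log 2 n + 1) * Real.log 2 := by simp [Real.log_pow]
      _ ≤ Nat.log 2 n + 1 :=
          mul_le_of_le_one_right (by positivity) (Real.log_two_lt_d9.le.trans (by norm_num))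

theorem ofReal_log_card_maximalPages_le (hk : 1 ≤ k) (hP : Fintype.card P = k + 1)
    (hℓ : Function.Surjective ℓ) (i : Fin m) :
    ENNReal.ofReal (Real.log #((pathEAG ℓ).maximalPages i)) ≤ 3 * (pathEAG ℓ).rOblAsymp k := by
  rcases Nat.eq_zero_or_pos #((pathEAG ℓ).maximalPages i) with h0 | hpos
  · simp [h0]
  obtain ⟨S, hS, hcard⟩ := Finset.exists_subset_card_eq (Nat.pow_log_le_self 2 hpos.ne')
  obtain ⟨W, hW⟩ := exists_isHardRound hk (by omega) hS hcard
  calc ENNReal.ofReal (Real.log #((pathEAG ℓ).maximalPages i))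
      ≤ ENNReal.ofReal (Nat.log 2 #((pathEAG ℓ).maximalPages i) + 1) :=
        ENNReal.ofReal_le_ofReal (log_le_natLog_two_add_one _)
    _ = Nat.log 2 #((pathEAG ℓ).maximalPages i) + 1 := by
        exact_mod_cast ENNReal.ofReal_natCast (Nat.log 2 #((pathEAG ℓ).maximalPages i) + 1)
    _ ≤ 2 * (pathEAG ℓ).rOblAsymp k + (pathEAG ℓ).rOblAsymp k :=
        add_le_add (hW.le_two_mul_rOblAsymp (Finset.card_pos.1 (hcard ▸ by positivity)) hP.le)
          (ExtendedAccessGraph.one_le_rOblAsymp hk (by omega)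
            (SimpleGraph.pathGraph_preconnected m) hℓ)
    _ = 3 * (pathEAG ℓ).rOblAsymp k := by ring

theorem ofReal_maxLogMaximal_le (hk : 1 ≤ k) (hP : Fintype.card P = k + 1)
    (hℓ : Function.Surjective ℓ) :
    ENNReal.ofReal (maxLogMaximal ℓ) ≤ 3 * (pathEAG ℓ).rOblAsymp k := by
  have : Nonempty P := Fintype.card_pos_iff.1 (by omega)
  have : Nonempty (Fin m) := (hℓ (Classical.arbitrary P)).nonempty
  obtain ⟨i, hi⟩ := exists_eq_ciSup_of_finite
    (f := fun i : Fin m => Real.log #((pathEAG ℓ).maximalPages i))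
  exact (congrArg ENNReal.ofReal hi.symm).trans_le (ofReal_log_card_maximalPages_le hk hP hℓ i)

end LowerBound

/-! ### The eviction rule of MAXFAR -/

section Victim

variable {m : ℕ} {P : Type*} {ℓ : Fin m → P} {i u v : Fin m} {k : ℕ} {N N' : Finset P} {p q : P}

open scoped Classical in
/-- MAXFAR may evict `q` in a phase that began at `i` if `N` is the set of unmarked
`≺_i`-maximal pages. -/
def VictimRule (ℓ : Fin m → P) (i : Fin m) (N : Finset P) (q : P) : Prop :=
  if (N.filter fun p => OnBothSides ℓ i p).Nonempty then
    IsMiddle ℓ i (N.filter fun p => OnBothSides ℓ i p) q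
  else q ∈ N

theorem VictimRule.mem (h : VictimRule ℓ i N q) : q ∈ N := by
  classical
  unfold VictimRule at h
  split_ifs at h
  · exact (Finset.mem_filter.1 h.1).1
  · exact h

open scoped Classical in
/-- A bound for the number of faults of MAXFAR in the rest of a phase that began at `i`, if `N` is
the set of unmarked `≺_i`-maximal pages. The binary length `Nat.size` goes down whenever the
number is halved. -/
noncomputable def victimPotential (ℓ : Fin m → P) (i : Fin m) (N : Finset P) : ℕ :=
  Nat.size #{p ∈ N | OnBothSides ℓ i p} + #{p ∈ N | ¬OnBothSides ℓ i p}

theorem victimPotential_mono (ℓ : Fin m → P) (i : Fin m) (h : N' ⊆ N) :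
    victimPotential ℓ i N' ≤ victimPotential ℓ i N := by
  classical
  exact add_le_add (Nat.size_le_size (Finset.card_le_card (Finset.filter_subset_filter _ h)))
    (Finset.card_le_card (Finset.filter_subset_filter _ h))

theorem size_lt_size_of_two_mul_le {a b : ℕ} (h : 2 * a ≤ b) (hb : 0 < b) : a.size < b.size := by
  rw [Nat.lt_size]
  rcases a.eq_zero_or_pos with rfl | ha
  · simpa using Nat.succ_le_of_lt hb
  · obtain ⟨s, hs⟩ := Nat.exists_eq_add_one.2 (Nat.size_pos.2 ha)
    have hle : 2 ^ s ≤ a := Nat.lt_size.1 (by omega)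
    rw [hs, pow_succ]
    omega

variable [Fintype P] [DecidableEq P]

theorem maxfarVictim_iff {σ : List (Fin m)} :
    MaxfarVictim ℓ k σ q ↔ ∃ i, ((pathEAG ℓ).currentPhase k σ).head? = some i ∧
      VictimRule ℓ i (unmarkedMaximal ℓ k σ i) q :=
  Iff.rfl

theorem exists_isMiddle (hN : N ⊆ (pathEAG ℓ).maximalPages i) (hne : N.Nonempty) :
    ∃ q, IsMiddle ℓ i N q := by
  classical
  obtain ⟨q, hq, hcard⟩ := exists_card_leftBefore_eq hN (Nat.div_lt_self hne.card_pos one_lt_two)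
  have hlt : #{p ∈ N | LeftBefore ℓ i q p} + #{p ∈ N | LeftBefore ℓ i p q} < #N := by
    rw [← Finset.card_union_of_disjoint (Finset.disjoint_filter.2 fun p _ hqp hpq =>
      not_leftBefore_self ℓ i q (hqp.trans hpq)), ← Finset.filter_or]
    exact Finset.card_lt_card (Finset.filter_ssubset.2 ⟨q, hq, by simp [not_leftBefore_self]⟩)
  exact ⟨q, hq, by omega, by omega⟩

theorem exists_victimRule (hN : N ⊆ (pathEAG ℓ).maximalPages i) (hne : N.Nonempty) :
    ∃ q, VictimRule ℓ i N q := by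
  classical
  unfold VictimRule
  split_ifs with h
  · exact exists_isMiddle ((N.filter_subset _).trans hN) h
  · exact hne

-- A path from `i` to `q` that misses a page of `N` goes in the direction in which `q` comes first.
theorem IsMiddle.two_mul_card_le (h : IsMiddle ℓ i N q) (hN : N ⊆ (pathEAG ℓ).maximalPages i)
    (hN' : N' ⊆ N) (hu : ℓ u = q) (hmiss : ∀ p ∈ N', p ∉ ℓ '' Set.uIcc i u) :
    2 * #N' ≤ #N := by
  classical
  obtain ⟨hq, hbefore, hafter⟩ := h
  have hqu : q ∈ ℓ '' Set.uIcc i u := ⟨u, Set.right_mem_uIcc, hu⟩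
  have hne : ∀ p ∈ N', p ≠ q := fun p hp hpq => hmiss p hp (hpq ▸ hqu)
  have htotal : ∀ p ∈ N', LeftBefore ℓ i p q ∨ LeftBefore ℓ i q p := fun p hp =>
    leftBefore_or_leftBefore (hN (hN' hp)) (hN hq) (hne p hp)
  rcases le_total u i with hui | hiu
  · refine (Nat.mul_le_mul_left 2 (Finset.card_le_card fun p hp => ?_)).trans hafter
    refine Finset.mem_filter.2 ⟨hN' hp, (htotal p hp).resolve_left fun hpq => ?_⟩
    have : Nontrivial P := ⟨p, q, hne p hp⟩
    exact hpq.notMem_image_uIcc_left (hN hq) hui (hmiss p hp) hqu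
  · refine (Nat.mul_le_mul_left 2 (Finset.card_le_card fun p hp => ?_)).trans hbefore
    refine Finset.mem_filter.2 ⟨hN' hp, (htotal p hp).resolve_right fun hqp => ?_⟩
    exact hqp.notMem_image_uIcc_right (hN hq) hiu (hmiss p hp) hqu

theorem VictimRule.victimPotential_lt (h : VictimRule ℓ i N q)
    (hN : N ⊆ (pathEAG ℓ).maximalPages i) (hN' : N' ⊆ N) (hu : ℓ u = q)
    (hmiss : ∀ p ∈ N', p ∉ ℓ '' Set.uIcc i u) :
    victimPotential ℓ i N' < victimPotential ℓ i N := by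
  classical
  unfold VictimRule at h
  unfold victimPotential
  split_ifs at h with hboth
  · refine add_lt_add_of_lt_of_le (size_lt_size_of_two_mul_le ?_ hboth.card_pos)
      (Finset.card_le_card (Finset.filter_subset_filter _ hN'))
    exact h.two_mul_card_le ((N.filter_subset _).trans hN) (Finset.filter_subset_filter _ hN') hu
      fun p hp => hmiss p (Finset.mem_filter.1 hp).1
  · have hq : ¬OnBothSides ℓ i q := fun hq => hboth ⟨q, Finset.mem_filter.2 ⟨h, hq⟩⟩
    have hqN' : q ∉ N' := fun hq => hmiss q hq ⟨u, Set.right_mem_uIcc, hu⟩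
    refine add_lt_add_of_le_of_lt
      (Nat.size_le_size (Finset.card_le_card (Finset.filter_subset_filter _ hN')))
      (Finset.card_lt_card ((Finset.ssubset_iff_of_subset (Finset.filter_subset_filter _ hN')).2
        ⟨q, Finset.mem_filter.2 ⟨h, hq⟩, fun hq => hqN' (Finset.mem_filter.1 hq).1⟩))

theorem victimPotential_maximalPages_le (ℓ : Fin m → P) (i : Fin m) :
    victimPotential ℓ i ((pathEAG ℓ).maximalPages i) ≤
      Nat.size #((pathEAG ℓ).maximalPages i) + 2 := by
  classical
  exact add_le_add (Nat.size_le_size (Finset.card_le_card (Finset.filter_subset _ _)))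
    (card_maximalPages_filter_not_onBothSides_le ℓ i)

theorem unmarkedMaximal_subset (ℓ : Fin m → P) (k : ℕ) (σ : List (Fin m)) (i : Fin m) :
    unmarkedMaximal ℓ k σ i ⊆ (pathEAG ℓ).maximalPages i :=
  Finset.sdiff_subset

theorem unmarkedMaximal_append_singleton_subset {σ : List (Fin m)}
    (h : ¬(pathEAG ℓ).StartsPhase k σ v) (i : Fin m) :
    unmarkedMaximal ℓ k (σ ++ [v]) i ⊆ unmarkedMaximal ℓ k σ i := by
  refine Finset.sdiff_subset_sdiff le_rfl ?_
  rw [ExtendedAccessGraph.marked_append_singleton, if_neg h]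
  exact Finset.subset_insert _ _

theorem notMem_image_uIcc_of_mem_unmarkedMaximal {σ τ : List (Fin m)}
    (hσ : (pathEAG ℓ).IsWalk σ) (hphase : (pathEAG ℓ).currentPhase k σ = i :: τ)
    (hu : u ∈ i :: τ) (hp : p ∈ unmarkedMaximal ℓ k σ i) : p ∉ ℓ '' Set.uIcc i u := by
  rintro ⟨x, hx, rfl⟩
  have hwalk : (pathEAG ℓ).IsWalk (i :: τ) := hphase ▸ hσ.currentPhase
  refine (Finset.mem_sdiff.1 hp).2 ?_
  rw [ExtendedAccessGraph.marked, hphase, List.mem_toFinset]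
  exact List.mem_map_of_mem (hwalk.uIcc_subset hu x hx)

theorem MaxfarVictim.notMem_marked {σ : List (Fin m)} (h : MaxfarVictim ℓ k σ q) :
    q ∉ (pathEAG ℓ).marked k σ := by
  obtain ⟨i, -, hi⟩ := maxfarVictim_iff.1 h
  exact (Finset.mem_sdiff.1 hi.mem).2

theorem exists_maxfarVictim (hk : 1 ≤ k) (hP : k < Fintype.card P) (hℓ : Function.Surjective ℓ)
    {σ : List (Fin m)} (hσ : (pathEAG ℓ).IsWalk σ) (hne : σ ≠ []) :
    ∃ q, MaxfarVictim ℓ k σ q := by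
  have hphase : (pathEAG ℓ).currentPhase k σ ≠ [] := ExtendedAccessGraph.currentPhase_ne_nil hne
  have hhead := List.head?_eq_some_head hphase
  obtain ⟨p, hp, hpm⟩ := ExtendedAccessGraph.exists_mem_maximalPages_notMem_marked hk hP
    (SimpleGraph.pathGraph_preconnected m) hℓ hσ hhead
  obtain ⟨q, hq⟩ :=
    exists_victimRule (unmarkedMaximal_subset ℓ k σ _) ⟨p, Finset.mem_sdiff.2 ⟨hp, hpm⟩⟩
  exact ⟨q, maxfarVictim_iff.2 ⟨_, hhead, hq⟩⟩

end Victim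

/-! ### MAXFAR -/

section Maxfar

variable {m : ℕ} {P : Type*} [Fintype P] [DecidableEq P] {ℓ : Fin m → P} {k : ℕ}

open scoped Classical in
/-- The memory of MAXFAR after a request for `v`, if it was `S` after the requests `σ`. The value
`{ℓ v}` is for sets `S` from which no page can be evicted; they do not occur. -/
noncomputable def maxfarStep (ℓ : Fin m → P) (k : ℕ) (σ : List (Fin m)) (S : Finset P) (v : Fin m) :
    Finset P :=
  if ℓ v ∈ S then S
  else if #S < k then insert (ℓ v) S
  else if h : ∃ q ∈ S, MaxfarVictim ℓ k (σ ++ [v]) q then insert (ℓ v) (S.erase h.choose)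
  else {ℓ v}

theorem label_mem_maxfarStep (ℓ : Fin m → P) (k : ℕ) (σ : List (Fin m)) (S : Finset P)
    (v : Fin m) : ℓ v ∈ maxfarStep ℓ k σ S v := by
  unfold maxfarStep
  split_ifs <;> simp [*]

theorem maxfarStep_subset (ℓ : Fin m → P) (k : ℕ) (σ : List (Fin m)) (S : Finset P)
    (v : Fin m) : maxfarStep ℓ k σ S v ⊆ insert (ℓ v) S := by
  unfold maxfarStep
  split_ifs
  · exact Finset.subset_insert _ _
  · exact subset_rfl
  · exact Finset.insert_subset_insert _ (Finset.erase_subset _ _)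
  · simp

theorem card_maxfarStep_le (hk : 1 ≤ k) (ℓ : Fin m → P) (σ : List (Fin m)) (S : Finset P)
    (v : Fin m) (hS : #S ≤ k) : #(maxfarStep ℓ k σ S v) ≤ k := by
  unfold maxfarStep
  split_ifs with _ hfree hvictim
  · exact hS
  · exact (Finset.card_insert_le _ _).trans hfree
  · refine (Finset.card_insert_le _ _).trans ?_
    rwa [Finset.card_erase_add_one hvictim.choose_spec.1]
  · simpa

/-- The algorithm MAXFAR, with ties broken by choice. -/
noncomputable def maxfar (hk : 1 ≤ k) (ℓ : Fin m → P) : OnlineAlg (pathEAG ℓ) k :=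
  .ofStep (maxfarStep ℓ k) (label_mem_maxfarStep ℓ k) (maxfarStep_subset ℓ k)
    (card_maxfarStep_le hk ℓ)

theorem eq_erase_of_notMem_of_card_eq (hP : Fintype.card P = k + 1) {S : Finset P} {p : P}
    (hp : p ∉ S) (hS : #S = k) : S = Finset.univ.erase p := by
  refine Finset.eq_of_subset_of_card_le (Finset.subset_erase.2 ⟨Finset.subset_univ S, hp⟩) ?_
  rw [Finset.card_erase_of_mem (Finset.mem_univ p), Finset.card_univ, hP, hS, Nat.add_sub_cancel]

theorem isMaxfar_maxfar (hk : 1 ≤ k) (hP : Fintype.card P = k + 1)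
    (hℓ : Function.Surjective ℓ) : IsMaxfar ℓ k (maxfar hk ℓ) := by
  intro σ v hσ
  have hserve : (maxfar hk ℓ).serve (σ ++ [v]) = maxfarStep ℓ k σ ((maxfar hk ℓ).serve σ) v :=
    OnlineAlg.ofStep_serve_append_singleton _ _ _ _ σ v
  rw [hserve]
  set S := (maxfar hk ℓ).serve σ
  refine ⟨fun hhit => if_pos hhit, fun hfault hfree => ?_, fun hfault hfull => ?_⟩
  · rw [maxfarStep, if_neg hfault, if_pos hfree]
  · obtain ⟨q, hq⟩ := exists_maxfarVictim hk (by omega) hℓ hσ (by simp)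
    have hqS : q ∈ S := by
      rw [eq_erase_of_notMem_of_card_eq hP hfault hfull, Finset.mem_erase]
      refine ⟨?_, Finset.mem_univ q⟩
      rintro rfl
      exact hq.notMem_marked (ExtendedAccessGraph.label_mem_marked_append_singleton σ v)
    have hvictim : ∃ q ∈ S, MaxfarVictim ℓ k (σ ++ [v]) q := ⟨q, hqS, hq⟩
    refine ⟨_, hvictim.choose_spec.1, hvictim.choose_spec.2, ?_⟩
    rw [maxfarStep, if_neg hfault, if_neg hfull.not_lt, dif_pos hvictim]

namespace IsMaxfar

variable {A : OnlineAlg (pathEAG ℓ) k} {σ pre τ : List (Fin m)} {i v : Fin m} {B : ℕ}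

theorem marked_subset_serve (hA : IsMaxfar ℓ k A) (hσ : (pathEAG ℓ).IsWalk σ) :
    (pathEAG ℓ).marked k σ ⊆ A.serve σ := by
  induction σ using List.reverseRecOn with
  | nil => simp
  | append_singleton σ v ih =>
    obtain ⟨hhit, hfree, hfull⟩ := hA σ v hσ
    have hsub : (pathEAG ℓ).marked k (σ ++ [v]) ⊆ insert (ℓ v) (A.serve σ) :=
      (ExtendedAccessGraph.marked_append_singleton_subset σ v).trans
        (Finset.insert_subset_insert _ (ih hσ.left_of_append))
    by_cases hv : ℓ v ∈ A.serve σ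
    · rwa [hhit hv, ← Finset.insert_eq_self.2 hv]
    obtain hlt | heq := (A.card_serve_le σ).lt_or_eq
    · rwa [hfree hv hlt]
    · obtain ⟨q, -, hq, hserve⟩ := hfull hv heq
      rw [hserve]
      intro p hp
      have hpq : p ≠ q := ne_of_mem_of_not_mem hp hq.notMem_marked
      have := hsub hp
      grind

theorem faults_le_card_toFinset (hA : IsMaxfar ℓ k A) (hσ : (pathEAG ℓ).IsWalk σ)
    (hphase : (pathEAG ℓ).currentPhase k σ = σ) : A.faults σ ≤ #(σ.map ℓ).toFinset := by
  induction σ using List.reverseRecOn with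
  | nil => simp
  | append_singleton σ v ih =>
    have hphaseσ : (pathEAG ℓ).currentPhase k σ = σ := by
      rw [ExtendedAccessGraph.currentPhase_append_singleton] at hphase
      split_ifs at hphase
      · obtain rfl : σ = [] := by simpa using hphase
        rfl
      · exact List.append_cancel_right hphase
    have hmarked : (σ.map ℓ).toFinset ⊆ A.serve σ := by
      have := hA.marked_subset_serve hσ.left_of_append
      rwa [ExtendedAccessGraph.marked, hphaseσ] at this
    have ih := ih hσ.left_of_append hphaseσ
    have hinsert : ((σ ++ [v]).map ℓ).toFinset = insert (ℓ v) (σ.map ℓ).toFinset :=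
      ExtendedAccessGraph.toFinset_map_append_singleton (G := pathEAG ℓ) σ v
    rw [A.faults_append_singleton, hinsert]
    split_ifs with hv
    · exact ih.trans (Finset.card_le_card (Finset.subset_insert _ _))
    · have hnew : ℓ v ∉ (σ.map ℓ).toFinset := fun h => hv (hmarked h)
      rw [Finset.card_insert_of_notMem hnew]
      omega

theorem serve_eq_erase_of_startsPhase (hk : 1 ≤ k) (hP : Fintype.card P = k + 1)
    (hA : IsMaxfar ℓ k A) (hσ : (pathEAG ℓ).IsWalk σ) (h : (pathEAG ℓ).StartsPhase k σ v) :
    A.serve σ = Finset.univ.erase (ℓ v) := by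
  have hlt : k < #(insert (ℓ v) ((pathEAG ℓ).marked k σ)) := h
  have hle : #((pathEAG ℓ).marked k σ) ≤ k := ExtendedAccessGraph.card_marked_le hk σ
  have hv : ℓ v ∉ (pathEAG ℓ).marked k σ := fun hv => by
    rw [Finset.insert_eq_self.2 hv] at hlt
    omega
  rw [Finset.card_insert_of_notMem hv] at hlt
  rw [← eq_erase_of_notMem_of_card_eq hP hv (by omega)]
  exact (Finset.eq_of_subset_of_card_le (hA.marked_subset_serve hσ)
    ((A.card_serve_le σ).trans (by omega))).symm

theorem exists_victim_of_serve_eq_erase (hP : Fintype.card P = k + 1) (hA : IsMaxfar ℓ k A)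
    (hσ : (pathEAG ℓ).IsWalk (σ ++ [v])) (hS : A.serve σ = Finset.univ.erase (ℓ v)) :
    ∃ q, MaxfarVictim ℓ k (σ ++ [v]) q ∧ A.serve (σ ++ [v]) = Finset.univ.erase q ∧
      A.faults (σ ++ [v]) = A.faults σ + 1 := by
  have hv : ℓ v ∉ A.serve σ := by simp [hS]
  obtain ⟨q, -, hq, hserve⟩ := (hA σ v hσ).2.2 hv (by simp [hS, hP])
  refine ⟨q, hq, ?_, ?_⟩
  · have hne : ℓ v ≠ q := ne_of_mem_of_not_mem
      (ExtendedAccessGraph.label_mem_marked_append_singleton σ v) hq.notMem_marked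
    rw [hserve, hS]
    grind
  · rw [A.faults_append_singleton]
    exact congrArg _ (if_neg hv)

-- `q` is the page that was evicted last, and `N` the set from which it was chosen.
theorem exists_faults_add_victimPotential_le (hk : 1 ≤ k) (hP : Fintype.card P = k + 1)
    (hA : IsMaxfar ℓ k A) (hσ : (pathEAG ℓ).IsWalk (pre ++ i :: τ)) (hpre : pre ≠ [])
    (hphase : (pathEAG ℓ).currentPhase k (pre ++ i :: τ) = i :: τ) :
    ∃ q N, A.serve (pre ++ i :: τ) = Finset.univ.erase q ∧ VictimRule ℓ i N q ∧
      N ⊆ (pathEAG ℓ).maximalPages i ∧ unmarkedMaximal ℓ k (pre ++ i :: τ) i ⊆ N ∧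
      A.faults (pre ++ i :: τ) + victimPotential ℓ i N ≤
        A.faults pre + victimPotential ℓ i ((pathEAG ℓ).maximalPages i) + 1 := by
  induction τ using List.reverseRecOn with
  | nil =>
    have hstart := ExtendedAccessGraph.startsPhase_of_currentPhase_eq hpre hphase
    obtain ⟨q, hq, hserve, hfaults⟩ := hA.exists_victim_of_serve_eq_erase hP hσ
      (hA.serve_eq_erase_of_startsPhase hk hP hσ.left_of_append hstart)
    obtain ⟨j, hj, hrule⟩ := maxfarVictim_iff.1 hq
    obtain rfl : i = j := by rwa [hphase, List.head?_cons, Option.some_inj] at hj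
    have hN := unmarkedMaximal_subset ℓ k (pre ++ [i]) i
    have := victimPotential_mono ℓ i hN
    exact ⟨q, _, hserve, hrule, hN, subset_rfl, by omega⟩
  | append_singleton τ v ih =>
    obtain ⟨hphase', hstart⟩ := ExtendedAccessGraph.currentPhase_eq_of_append_singleton hphase
    rw [← List.cons_append, ← List.append_assoc] at hσ hphase ⊢
    obtain ⟨q, N, hserve, hrule, hN, hunmarked, hle⟩ := ih hσ.left_of_append hphase'
    have hN' := (unmarkedMaximal_append_singleton_subset hstart i).trans hunmarked
    by_cases hv : ℓ v = q
    · obtain ⟨q', hq', hserve', hfaults⟩ :=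
        hA.exists_victim_of_serve_eq_erase hP hσ (hv ▸ hserve)
      obtain ⟨j, hj, hrule'⟩ := maxfarVictim_iff.1 hq'
      obtain rfl : i = j := by
        rwa [hphase, List.cons_append, List.head?_cons, Option.some_inj] at hj
      have hlt := hrule.victimPotential_lt hN hN' hv fun p =>
        notMem_image_uIcc_of_mem_unmarkedMaximal hσ hphase (by simp)
      exact ⟨q', _, hserve', hrule', unmarkedMaximal_subset _ _ _ _, subset_rfl, by omega⟩
    · have hhit : ℓ v ∈ A.serve (pre ++ i :: τ) := by simp [hserve, hv]
      have hfaults : A.faults (pre ++ i :: τ ++ [v]) = A.faults (pre ++ i :: τ) := by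
        rw [A.faults_append_singleton]
        exact congrArg _ (if_pos hhit)
      exact ⟨q, N, ((hA _ v hσ).1 hhit).trans hserve, hrule, hN, hN', hfaults ▸ hle⟩

theorem faults_append_le (hk : 1 ≤ k) (hP : Fintype.card P = k + 1) (hA : IsMaxfar ℓ k A)
    (hB : ∀ i, Nat.size #((pathEAG ℓ).maximalPages i) + 3 ≤ B)
    (hσ : (pathEAG ℓ).IsWalk (pre ++ τ)) (hpre : pre ≠ [])
    (hphase : (pathEAG ℓ).currentPhase k (pre ++ τ) = τ) :
    A.faults (pre ++ τ) ≤ A.faults pre + B := by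
  obtain ⟨i, τ, rfl⟩ := List.exists_cons_of_ne_nil
    (hphase ▸ ExtendedAccessGraph.currentPhase_ne_nil (by simp [hpre]) : τ ≠ [])
  obtain ⟨q, N, -, -, -, -, hle⟩ :=
    hA.exists_faults_add_victimPotential_le hk hP hσ hpre hphase
  have := victimPotential_maximalPages_le ℓ i
  have := hB i
  omega

theorem faults_le_card_add_mul_phaseChanges (hk : 1 ≤ k) (hP : Fintype.card P = k + 1)
    (hA : IsMaxfar ℓ k A) (hB : ∀ i, Nat.size #((pathEAG ℓ).maximalPages i) + 3 ≤ B)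
    (hσ : (pathEAG ℓ).IsWalk σ) :
    A.faults σ ≤ #(σ.map ℓ).toFinset + B * (pathEAG ℓ).phaseChanges k σ := by
  induction hn : σ.length using Nat.strong_induction_on generalizing σ with
  | _ n ih =>
    obtain ⟨pre, hpre⟩ :=
      ExtendedAccessGraph.exists_eq_append_currentPhase (G := pathEAG ℓ) (k := k) σ
    set τ := (pathEAG ℓ).currentPhase k σ with hτ
    obtain rfl | hne := eq_or_ne pre []
    · have := hA.faults_le_card_toFinset hσ (hτ.symm.trans hpre.symm)
      omega
    have hτne : τ ≠ [] := ExtendedAccessGraph.currentPhase_ne_nil (by simp [hpre, hne])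
    have hτpos := List.length_pos_iff.2 hτne
    clear_value τ
    subst hpre
    have ih := ih pre.length (by simp [← hn, hτpos]) hσ.left_of_append rfl
    have hphase := hA.faults_append_le hk hP hB hσ hne hτ.symm
    have hmono : #(pre.map ℓ).toFinset ≤ #((pre ++ τ).map ℓ).toFinset := by
      refine Finset.card_le_card ?_
      rw [List.map_append, List.toFinset_append]
      exact Finset.subset_union_left
    rw [ExtendedAccessGraph.phaseChanges_append hne hτ.symm, mul_add, mul_one]
    omega

theorem faults_le_mul_optCost (hk : 1 ≤ k) (hP : Fintype.card P = k + 1) (hA : IsMaxfar ℓ k A)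
    (hB : ∀ i, Nat.size #((pathEAG ℓ).maximalPages i) + 3 ≤ B) (hσ : (pathEAG ℓ).IsWalk σ) :
    A.faults σ ≤ (1 + B) * optCost k (σ.map ℓ) := by
  have hpages : #(σ.map ℓ).toFinset ≤ optCost k (σ.map ℓ) :=
    le_optCost hk fun C hC => hC.card_toFinset_le
  have hphases : (pathEAG ℓ).phaseChanges k σ ≤ optCost k (σ.map ℓ) :=
    ExtendedAccessGraph.phaseChanges_le_optCost hk σ
  calc A.faults σ ≤ #(σ.map ℓ).toFinset + B * (pathEAG ℓ).phaseChanges k σ :=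
        hA.faults_le_card_add_mul_phaseChanges hk hP hB hσ
    _ ≤ optCost k (σ.map ℓ) + B * optCost k (σ.map ℓ) :=
        add_le_add hpages (Nat.mul_le_mul_left B hphases)
    _ = (1 + B) * optCost k (σ.map ℓ) := by ring

end IsMaxfar

theorem size_le_one_add_two_mul_log (n : ℕ) : (n.size : ℝ) ≤ 1 + 2 * Real.log n := by
  rcases n.eq_zero_or_pos with rfl | hn
  · simp
  obtain ⟨s, hs⟩ := Nat.exists_eq_add_one.2 (Nat.size_pos.2 hn)
  have hpow : ((2 ^ s : ℕ) : ℝ) ≤ n := Nat.cast_le.2 (Nat.lt_size.1 (by omega))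
  have hlog : s * Real.log 2 ≤ Real.log n := by
    simpa using Real.log_le_log (by positivity) hpow
  have hhalf : (s : ℝ) * (1 / 2) ≤ s * Real.log 2 := by
    gcongr
    linarith [Real.log_two_gt_d9]
  rw [hs]
  push_cast
  linarith

theorem log_card_maximalPages_le_maxLogMaximal (ℓ : Fin m → P) (i : Fin m) :
    Real.log #((pathEAG ℓ).maximalPages i) ≤ maxLogMaximal ℓ :=
  le_ciSup (f := fun i : Fin m => Real.log #((pathEAG ℓ).maximalPages i))
    (Set.finite_range _).bddAbove i

theorem maxLogMaximal_nonneg (ℓ : Fin m → P) : 0 ≤ maxLogMaximal ℓ :=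
  Real.iSup_nonneg fun _ => Real.log_natCast_nonneg _

theorem exists_size_card_maximalPages_add_three_le (ℓ : Fin m → P) :
    ∃ B : ℕ, (∀ i, Nat.size #((pathEAG ℓ).maximalPages i) + 3 ≤ B) ∧
      (B : ℝ) ≤ 4 + 2 * maxLogMaximal ℓ := by
  have hnonneg := maxLogMaximal_nonneg ℓ
  refine ⟨⌊4 + 2 * maxLogMaximal ℓ⌋₊, fun i => Nat.le_floor ?_, Nat.floor_le (by linarith)⟩
  have hsize := size_le_one_add_two_mul_log #((pathEAG ℓ).maximalPages i)
  have hlog := log_card_maximalPages_le_maxLogMaximal ℓ i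
  push_cast
  linarith

theorem IsMaxfar.strictRatio_le (hk : 1 ≤ k) (hP : Fintype.card P = k + 1)
    (hℓ : Function.Surjective ℓ) {A : OnlineAlg (pathEAG ℓ) k} (hA : IsMaxfar ℓ k A) :
    A.strictRatio ≤ 11 * (pathEAG ℓ).rOblAsymp k := by
  obtain ⟨B, hB, hBlog⟩ := exists_size_card_maximalPages_add_three_le ℓ
  have hone : 1 ≤ (pathEAG ℓ).rOblAsymp k := ExtendedAccessGraph.one_le_rOblAsymp hk (by omega)
    (SimpleGraph.pathGraph_preconnected m) hℓ
  calc A.strictRatio ≤ ((1 + B : ℕ) : ℝ≥0∞) :=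
        sInf_le fun σ hσ => by exact_mod_cast hA.faults_le_mul_optCost hk hP hB hσ
    _ = ENNReal.ofReal (1 + B : ℕ) := (ENNReal.ofReal_natCast _).symm
    _ ≤ ENNReal.ofReal (5 + 2 * maxLogMaximal ℓ) := by
        refine ENNReal.ofReal_le_ofReal ?_
        push_cast
        linarith
    _ = 5 + 2 * ENNReal.ofReal (maxLogMaximal ℓ) := by
        rw [ENNReal.ofReal_add (by norm_num) (by linarith [maxLogMaximal_nonneg ℓ]),
          ENNReal.ofReal_mul (by norm_num)]
        simp
    _ ≤ 5 * (pathEAG ℓ).rOblAsymp k + 2 * (3 * (pathEAG ℓ).rOblAsymp k) := by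
        gcongr
        · exact le_mul_of_one_le_right' hone
        · exact ofReal_maxLogMaximal_le hk hP hℓ
    _ = 11 * (pathEAG ℓ).rOblAsymp k := by ring

end Maxfar

theorem mainTheorem4 :
    ∃ c : ℝ≥0, ∀ (k m : ℕ) (P : Type*) [Fintype P] [DecidableEq P] (ℓ : Fin m → P),
      1 ≤ k → Fintype.card P = k + 1 → Function.Surjective ℓ →
      (∃ A : OnlineAlg (pathEAG ℓ) k, IsMaxfar ℓ k A) ∧
      (∀ A : OnlineAlg (pathEAG ℓ) k, IsMaxfar ℓ k A →
        A.strictRatio ≤ c * (pathEAG ℓ).rOblAsymp k ∧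
        A.strictRatio ≤ c * (pathEAG ℓ).rOblAsympPages k) ∧
      ENNReal.ofReal (maxLogMaximal ℓ) ≤ c * (pathEAG ℓ).rOblAsymp k ∧
      (∀ A : OnlineAlg (pathEAG ℓ) k, IsMaxfar ℓ k A →
        ∀ pre ph : List (Fin m), (pathEAG ℓ).IsWalk (pre ++ ph) → pre ≠ [] →
          (pathEAG ℓ).currentPhase k (pre ++ ph) = ph →
          (A.faults (pre ++ ph) : ℝ) ≤ A.faults pre + c * (1 + maxLogMaximal ℓ)) := by
  refine ⟨11, fun k m P _ _ ℓ hk hP hℓ => ⟨⟨maxfar hk ℓ, isMaxfar_maxfar hk hP hℓ⟩,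
    fun A hA => ⟨?_, ?_⟩, ?_, fun A hA pre ph hσ hpre hph => ?_⟩⟩
  · exact_mod_cast hA.strictRatio_le hk hP hℓ
  · refine (hA.strictRatio_le hk hP hℓ).trans ?_
    push_cast
    gcongr
    exact (pathEAG ℓ).rOblAsymp_le_rOblAsympPages k
  · refine (ofReal_maxLogMaximal_le hk hP hℓ).trans ?_
    push_cast
    gcongr
    norm_num
  · obtain ⟨B, hB, hBlog⟩ := exists_size_card_maximalPages_add_three_le ℓ
    have hfaults : (A.faults (pre ++ ph) : ℝ) ≤ A.faults pre + B := by
      exact_mod_cast hA.faults_append_le hk hP hB hσ hpre hph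
    have hnonneg := maxLogMaximal_nonneg ℓ
    push_cast
    linarith
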